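/- **Setting.** Let $\mathcal S,\mathcal A$ be finite sets with $|\mathcal S|=S$, $|\mathcal A|=A\ge 1$, let $H\ge 1$ be the horizon, $x_1\in\mathcal S$ the initial state, and let $\{\mathbb P_h(\cdot\mid x,a)\}_{h=1}^H$ be unknown transition probabilities; the MDP is *stationary* if $\mathbb P_h=\mathbb P$ does not depend on $h$. For a reward function $r=\{r_h:\mathcal S\times\mathcal A\to[0,1]\}_{h=1}^H$ and a policy $\pi=\{\pi_h\}$ (each $\pi_h$ maps states to distributions over actions), $V_1^\pi(x_1;r)$ is the expected total reward of an episode of length $H$ from $x_1$, and $V_1^*(x_1;r)=\sup_\pi V_1^\pi(x_1;r)$. **Algorithm PF-UCB with $d=SA$ objectives, $K$ episodes and confidence $\delta$.** From the data of the episodes before the $k$-th one, let $N^k(x,a,y)$ be the number of observed transitions $x\to y$ under action $a$ (over all $H$ steps of each episode), $N^k(x,a)=\sum_yN^k(x,a,y)$, and $\widehat{\mathbb P}^k(y\mid x,a)=N^k(x,a,y)/N^k(x,a)$ if $N^k(x,a)>0$ and $1/S$ otherwise. In the version for non-stationary MDPs these are replaced by counts $N^k_h$ and estimates $\widehat{\mathbb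 P}^k_h$ kept separately for each step $h$. Put $$b^k=\frac2K+\sqrt{\frac{\min\{d,S\}H^2\iota_K}{2N^k}},\qquad c^k=\frac{3H^2S\iota_K}{N^k}+2b^k,\qquad \iota_K=\log\frac{6H^2SAK^2}{\delta}$$ (all $+\infty$ where $N^k=0$). For a bonus $\beta$ and a reward $r$ let $V_{H+1}=0$, $Q_h(x,a)=\min\{H,\ r_h(x,a)+\beta(x,a)+\sum_y\widehat{\mathbb P}^k(y\mid x,a)V_{h+1}(y)\}$ and $V_h(x)=\max_aQ_h(x,a)$ for $h=H,\dots,1$. *Exploration*: in episode $k=1,\dots,K$, start in $x_1$ and act greedily with respect to the $Q$ obtained with bonus $c^k$ and reward $0$. *Planning*: given any reward $r$, let $\pi^k$ be the greedy policy of the $Q$ obtained with bonus $b^k$ and reward $r$, and output a policy $\pi_r$ drawn uniformly from $\{\pi^1,\dots,\pi^K\}$, so that $V_1^{\pi_r}(x_1;r)=\frac1K\sum_{k=1}^KV_1^{\pi^k}(x_1;r)$. Ties in $\arg\max$ are broken by an arbitrary fixed rule. The algorithm is *$(\epsilon,\delta)$-PAC for all reward functions* if, with probability at least $1-\delta$ over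 the exploration data, $$V_1^*(x_1;r)-V_1^{\pi_r}(x_1;r)\le\epsilon\quad\text{for all reward functions } r \text{ with values in } [0,1] \text{ simultaneously.}$$ **Corollary.** There is an absolute constant $C>0$ such that the following holds for all $\mathcal S,\mathcal A,x_1,H$ as above, all $\delta\in(0,1)$ and all sufficiently small $\epsilon$, namely all $\epsilon\in(0,1)$ with $\epsilon\,\iota\le H$, where $\iota:=\log\frac{HSA}{\delta\epsilon}$. 1. On every stationary MDP, PF-UCB run for any number $K\ge C\,\dfrac{H^3S^2A\,\iota}{\epsilon^2}$ of exploration episodes is $(\epsilon,\delta)$-PAC for all reward functions. 2. On every, possibly non-stationary, MDP, the version of PF-UCB for non-stationary MDPs run for any number $K\ge C\,\dfrac{H^4S^2A\,\iota}{\epsilon^2}$ of exploration episodes is $(\epsilon,\delta)$-PAC for all reward functions. -/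

import Mathlib

noncomputable section

namespace PFUCB

variable {S A : Type*}

/-! Conventions: the steps of an episode are numbered `0, …, H - 1`; step-indexed families are indexed
by `ℕ`, and only their members with index `< H` are ever used. -/

/-- A (non-stationary) transition law: `P h x a` is the law of the next state after taking action `a`
in state `x` at step `h`. A stationary one does not depend on `h`. -/
abbrev Transition (S A : Type*) := ℕ → S → A → PMF S

/-- A policy: at each step, a map from states to distributions over actions. -/
abbrev Policy (S A : Type*) := ℕ → S → PMF A

/-- A (scalar, step-dependent) reward function. -/
abbrev Reward (S A : Type*) := ℕ → S → A → ℝ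

/-- The rewards considered take values in `[0, 1]`. -/
def Reward.IsUnit (r : Reward S A) : Prop := ∀ h x a, r h x a ∈ Set.Icc (0 : ℝ) 1

/-- A segment of `m` consecutive interactions `(state, action, next state)`. -/
abbrev Segment (S A : Type*) (m : ℕ) := Fin m → S × A × S

/-- The law of the `m` interactions produced by following `π` from state `x` at step `h`. -/
def rollout (P : Transition S A) (π : Policy S A) : (m : ℕ) → ℕ → S → PMF (Segment S A m)
  | 0, _, _ => PMF.pure Fin.elim0
  | m + 1, h, x =>
    (π h x).bind fun a => (P h x a).bind fun y =>
      (rollout P π m (h + 1) y).map fun τ => Fin.cons (x, a, y) τ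

/-- The cumulative reward of a segment that starts at step `h`. -/
def cumReward (r : Reward S A) {m : ℕ} (h : ℕ) (τ : Segment S A m) : ℝ :=
  ∑ i : Fin m, r (h + i) (τ i).1 (τ i).2.1

/-- The value of `π` over an episode of length `H` that starts in `x`: its expected total reward. -/
def value [Fintype S] [Fintype A] (H : ℕ) (P : Transition S A) (r : Reward S A)
    (π : Policy S A) (x : S) : ℝ :=
  ∑ τ : Segment S A H, (rollout P π H 0 x τ).toReal * cumReward r 0 τ

/-- The optimal value: the supremum of the values of all policies. -/
def optValue [Fintype S] [Fintype A] (H : ℕ) (P : Transition S A) (r : Reward S A) (x : S) : ℝ :=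
  ⨆ π : Policy S A, value H P r π x

/-- The (expected) value of a policy drawn uniformly from the family `π`. -/
def uniformValue [Fintype S] [Fintype A] (H : ℕ) (P : Transition S A) (r : Reward S A) {K : ℕ}
    (π : Fin K → Policy S A) (x : S) : ℝ :=
  (∑ k : Fin K, value H P r (π k) x) / K

/-- The probability of an event under a discrete law. -/
def prob {Ω : Type*} (p : PMF Ω) (E : Set Ω) : ℝ := (p.toOuterMeasure E).toReal

/-- A reward-free method with exploration data distributed as `law`, whose planning phase outputs, for
data `D` and reward `r`, a policy drawn uniformly from the family `plan D r`, is `(ε, δ)`-PAC: with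
probability at least `1 - δ`, its output is `ε`-optimal for all rewards simultaneously. -/
def IsPAC [Fintype S] [Fintype A] (H : ℕ) (P : Transition S A) (x₁ : S) (ε δ : ℝ)
    {Ω : Type*} {K : ℕ} (law : PMF Ω) (plan : Ω → Reward S A → Fin K → Policy S A) : Prop :=
  1 - δ ≤ prob law {D | ∀ r : Reward S A, r.IsUnit →
    optValue H P r x₁ - uniformValue H P r (plan D r) x₁ ≤ ε}

/-- A choice of maximizer for each function of the actions (the way ties in `argmax` are broken). -/
structure ArgmaxRule (A : Type*) where
  pick : (A → ℝ) → A
  le_pick : ∀ (q : A → ℝ) (a : A), q a ≤ q (pick q)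

/-- The two versions of the algorithm: the stationary one pools the data of all steps, and the
non-stationary one keeps separate counts for every step. -/
inductive Version
  | stationary
  | nonstationary

/-- The data of `k` episodes of length `H`. -/
abbrev History (S A : Type*) (H k : ℕ) := Fin k → Segment S A H

section Algorithm

variable [Fintype S] [Fintype A] [DecidableEq S] [DecidableEq A]

/-- The number of transitions `(x, a, y)` in the data (at step `h`, for the non-stationary version). -/
def countNext (v : Version) {H k : ℕ} (D : History S A H k) (h : ℕ) (x : S) (a : A) (y : S) : ℕ :=
  match v with
  | .stationary =>
      (Finset.univ.filter fun p : Fin k × Fin H => D p.1 p.2 = (x, a, y)).card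
  | .nonstationary =>
      (Finset.univ.filter fun p : Fin k × Fin H => (p.2 : ℕ) = h ∧ D p.1 p.2 = (x, a, y)).card

/-- The number of visits to `(x, a)` in the data. -/
def count (v : Version) {H k : ℕ} (D : History S A H k) (h : ℕ) (x : S) (a : A) : ℕ :=
  ∑ y, countNext v D h x a y

/-- The empirical transition probability, uniform at unvisited pairs. -/
def empTrans (v : Version) {H k : ℕ} (D : History S A H k) (h : ℕ) (x : S) (a : A) (y : S) : ℝ :=
  if 0 < count v D h x a then (countNext v D h x a y : ℝ) / count v D h x a
  else 1 / (Fintype.card S : ℝ)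

/-- The logarithmic factor in the bonuses, for a run of `K` episodes with covering accuracy `1 / K`. -/
def logFactor (S A : Type*) [Fintype S] [Fintype A] (H K : ℕ) (δ : ℝ) : ℝ :=
  Real.log (6 * (H : ℝ) ^ 2 * Fintype.card S * Fintype.card A * K / (δ * (1 / (K : ℝ))))

/-- The planning bonus at a pair that has been visited `n > 0` times; `d` is the number of objectives. -/
def planBonus (S A : Type*) [Fintype S] [Fintype A] (d H K : ℕ) (δ : ℝ) (n : ℕ) : ℝ :=
  2 * (1 / (K : ℝ)) +
    √(((min d (Fintype.card S) : ℕ) : ℝ) * (H : ℝ) ^ 2 * logFactor S A H K δ / (2 * n))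

/-- The (enlarged) exploration bonus at a pair that has been visited `n > 0` times. -/
def exploreBonus (S A : Type*) [Fintype S] [Fintype A] (d H K : ℕ) (δ : ℝ) (n : ℕ) : ℝ :=
  3 * (H : ℝ) ^ 2 * Fintype.card S * logFactor S A H K δ / n + 2 * planBonus S A d H K δ n

/-- One step of optimistic value iteration, from the value estimate `V` of the next step. At an
unvisited pair the bonus is infinite, so that the truncated estimate equals `H`. -/
def ucbBackup (v : Version) {H k : ℕ} (D : History S A H k) (bonus : ℕ → ℝ) (r : Reward S A)
    (h : ℕ) (V : S → ℝ) (x : S) (a : A) : ℝ :=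
  if count v D h x a = 0 then (H : ℝ)
  else min (H : ℝ) (r h x a + bonus (count v D h x a) + ∑ y, empTrans v D h x a y * V y)

/-- The optimistic value estimate with `m` steps to go, i.e. at step `H - m`. -/
def ucbToGo [Nonempty A] (v : Version) {H k : ℕ} (D : History S A H k) (bonus : ℕ → ℝ)
    (r : Reward S A) : ℕ → S → ℝ
  | 0, _ => 0
  | m + 1, x => Finset.univ.sup' Finset.univ_nonempty fun a =>
      ucbBackup v D bonus r (H - (m + 1)) (ucbToGo v D bonus r m) x a

/-- The optimistic `Q`-value estimate at step `h`. -/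
def ucbQ [Nonempty A] (v : Version) {H k : ℕ} (D : History S A H k) (bonus : ℕ → ℝ)
    (r : Reward S A) (h : ℕ) (x : S) (a : A) : ℝ :=
  ucbBackup v D bonus r h (ucbToGo v D bonus r (H - (h + 1))) x a

/-- The greedy policy with respect to the optimistic `Q`-value estimate. -/
def greedy [Nonempty A] (g : ArgmaxRule A) (v : Version) {H k : ℕ} (D : History S A H k)
    (bonus : ℕ → ℝ) (r : Reward S A) : Policy S A :=
  fun h x => PMF.pure (g.pick (ucbQ v D bonus r h x))

/-- The exploration phase of a run of `K` episodes: the law of the data after the first `k` of them.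
Every episode follows the greedy policy for the zero reward and the exploration bonus. -/
def exploreLaw [Nonempty A] (g : ArgmaxRule A) (v : Version) (d H K : ℕ) (δ : ℝ)
    (P : Transition S A) (x₁ : S) : (k : ℕ) → PMF (History S A H k)
  | 0 => PMF.pure Fin.elim0
  | k + 1 =>
    (exploreLaw g v d H K δ P x₁ k).bind fun D =>
      (rollout P (greedy g v D (exploreBonus S A d H K δ) 0) H 0 x₁).map fun τ => Fin.snoc D τ

/-- The planning phase for the data `D` and the reward `r`: the `K` policies from which the output is
drawn uniformly. The `k`-th one uses the data of the episodes before the `k`-th. -/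
def planPolicies [Nonempty A] (g : ArgmaxRule A) (v : Version) (d H K : ℕ) (δ : ℝ)
    (D : History S A H K) (r : Reward S A) (k : Fin K) : Policy S A :=
  greedy g v (fun i : Fin k => D (Fin.castLE k.isLt.le i)) (planBonus S A d H K δ) r

end Algorithm

end PFUCB

end

/-! With `d = |S||A| ≥ |S|` the planning bonus is wide enough for total variation control. Off a
small event, every empirical transition law exceeds the true one by at most `√(|S| ι_K / (2n))` on
each set of states (`exists_concentrated`). So it estimates the expectations of all functions with
values in `[0, H]` at once, within the bonus. Value functions depending on the reward and on the
data are covered, so simultaneity over rewards needs neither a cover of the rewards nor the slack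
`2/K`.

Deterministically on that event, planning is optimistic (`valueFrom_le_ucbToGo`), and its excess
over the true value of the greedy policy obeys a recursion whose source is at most twice the
planning bonus. Exploration with zero reward maximizes a recursion with a larger source, so its
optimistic value dominates the planning error for every reward (`ucbToGo_sub_valueFrom_le`).

It remains to bound the sum of the exploration values over the episodes. Off a second small event it
equals, up to martingale noise, the sum along the observed trajectories of one-step drifts
(`exists_sum_ucbToGo_le`), and these are bounded by bonuses (`drift_le`). A potential argument over
the `M` cells of pooled data (`sum_visits_le`, `mul_le_potential_sub`) bounds the latter by order
`√(H³|S|M K ι_K)` plus a term of order `H²|S|M ι_K²`. Here `M = |S||A|` or `H|S||A|`, which accounts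
for the two sample sizes; the assumption `ε ι ≤ H` makes the second term harmless.

Both events are described by nonnegative functions that are at least 1 on failure and have small
mean, so union bounds are additions of such functions and Markov's inequality closes the argument
(`le_prob_of_expect`). -/

namespace PFUCB

/-! ### Expectations under finite laws; Hoeffding and Markov. -/

/-- The expectation of a function under a law on a finite type. -/
noncomputable def expect {Ω : Type*} [Fintype Ω] (p : PMF Ω) (f : Ω → ℝ) : ℝ :=
  ∑ ω, (p ω).toReal * f ω

section Expect

variable {Ω Ω' : Type*} [Fintype Ω] [Fintype Ω']

theorem sum_toReal (p : PMF Ω) : ∑ ω, (p ω).toReal = 1 := by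
  rw [← ENNReal.toReal_sum (fun ω _ => p.apply_ne_top ω), ← tsum_fintype (L := .unconditional Ω),
    p.tsum_coe, ENNReal.toReal_one]

theorem expect_const (p : PMF Ω) (c : ℝ) : expect p (fun _ => c) = c := by
  rw [expect, ← Finset.sum_mul, sum_toReal, one_mul]

theorem expect_mono (p : PMF Ω) {f g : Ω → ℝ} (h : ∀ ω, f ω ≤ g ω) : expect p f ≤ expect p g :=
  Finset.sum_le_sum fun ω _ => mul_le_mul_of_nonneg_left (h ω) ENNReal.toReal_nonneg

theorem expect_le (p : PMF Ω) {f : Ω → ℝ} {c : ℝ} (h : ∀ ω, f ω ≤ c) : expect p f ≤ c :=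
  (expect_mono p h).trans_eq (expect_const p c)

theorem le_expect (p : PMF Ω) {f : Ω → ℝ} {c : ℝ} (h : ∀ ω, c ≤ f ω) : c ≤ expect p f :=
  (expect_const p c).symm.trans_le (expect_mono p h)

theorem expect_add (p : PMF Ω) (f g : Ω → ℝ) :
    expect p (fun ω => f ω + g ω) = expect p f + expect p g := by
  simp [expect, mul_add, Finset.sum_add_distrib]

theorem expect_mul_left (p : PMF Ω) (c : ℝ) (f : Ω → ℝ) :
    expect p (fun ω => c * f ω) = c * expect p f := by
  simp only [expect, Finset.mul_sum]
  exact Finset.sum_congr rfl fun ω _ => by ring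

theorem expect_sum (p : PMF Ω) {ι : Type*} (s : Finset ι) (f : ι → Ω → ℝ) :
    expect p (fun ω => ∑ i ∈ s, f i ω) = ∑ i ∈ s, expect p (f i) := by
  simp only [expect, Finset.mul_sum]
  exact Finset.sum_comm

theorem expect_pure (ω : Ω) (f : Ω → ℝ) : expect (PMF.pure ω) f = f ω := by
  classical
  rw [expect, Finset.sum_eq_single ω]
  · simp
  · intro b _ hb
    simp [PMF.pure_apply, hb]
  · simp

theorem expect_bind (p : PMF Ω) (q : Ω → PMF Ω') (f : Ω' → ℝ) :
    expect (p.bind q) f = expect p fun ω => expect (q ω) f := by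
  have h : ∀ b, (p.bind q b).toReal = ∑ ω, (p ω).toReal * (q ω b).toReal := by
    intro b
    rw [PMF.bind_apply, tsum_fintype, ENNReal.toReal_sum]
    · simp [ENNReal.toReal_mul]
    · exact fun ω _ => ENNReal.mul_ne_top (p.apply_ne_top ω) ((q ω).apply_ne_top b)
  simp only [expect, h, Finset.sum_mul, Finset.mul_sum]
  rw [Finset.sum_comm]
  exact Finset.sum_congr rfl fun ω _ => Finset.sum_congr rfl fun b _ => by ring

theorem expect_map (p : PMF Ω) (φ : Ω → Ω') (f : Ω' → ℝ) :
    expect (p.map φ) f = expect p fun ω => f (φ ω) := by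
  rw [← PMF.bind_pure_comp, expect_bind]
  simp [expect_pure]

/-- Hoeffding's lemma. -/
theorem expect_exp_le (p : PMF Ω) (V : Ω → ℝ) {a b : ℝ} (hV : ∀ ω, V ω ∈ Set.Icc a b) (l : ℝ) :
    expect p (fun ω => Real.exp (l * (V ω - expect p V))) ≤ Real.exp (l ^ 2 * (b - a) ^ 2 / 8) := by
  let _ : MeasurableSpace Ω := ⊤
  have _ : MeasurableSingletonClass Ω := ⟨fun _ => trivial⟩
  have hint : ∀ f : Ω → ℝ, ∫ ω, f ω ∂p.toMeasure = expect p f := fun f => by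
    rw [PMF.integral_eq_sum]; simp [expect]
  have h := (ProbabilityTheory.hasSubgaussianMGF_of_mem_Icc (μ := p.toMeasure) (X := V) (a := a)
    (b := b) (measurable_of_finite V).aemeasurable (Filter.Eventually.of_forall hV)).mgf_le l
  rw [ProbabilityTheory.mgf, hint, hint] at h
  refine h.trans (Real.exp_le_exp.2 (le_of_eq ?_))
  push_cast
  rw [Real.norm_eq_abs, div_pow, sq_abs]
  ring

/-- A lower bound on the probability of an event from bounds on exponential-moment-like functions
that are large outside of it. -/
theorem le_prob_of_expect {p : PMF Ω} {E : Set Ω} {f : Ω → ℝ} {δ : ℝ} (hf : ∀ ω, 0 ≤ f ω)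
    (hE : ∀ ω ∉ E, 1 ≤ f ω) (hδ : expect p f ≤ δ) : 1 - δ ≤ prob p E := by
  classical
  have h1 : prob p E = expect p (E.indicator 1) := by
    rw [prob, PMF.toOuterMeasure_apply_fintype, ENNReal.toReal_sum]
    · refine Finset.sum_congr rfl fun ω _ => ?_
      by_cases h : ω ∈ E <;> simp [h]
    · intro ω _
      by_cases h : ω ∈ E <;> simp [h, p.apply_ne_top]
  have h2 : 1 ≤ expect p fun ω => E.indicator 1 ω + f ω := by
    refine le_expect p fun ω => ?_
    by_cases h : ω ∈ E
    · simpa [h] using hf ω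
    · simpa [h] using hE ω h
  rw [expect_add] at h2
  have : expect p (E.indicator 1) = expect p fun ω => E.indicator 1 ω := rfl
  linarith

end Expect

/-! ### Values and exponential supermartingales along one episode. -/

theorem cumReward_cons {S A : Type*} (r : Reward S A) (m h : ℕ) (x : S) (a : A) (y : S) (τ : Segment S A m) :
    cumReward r h (Fin.cons (x, a, y) τ : Segment S A (m + 1)) =
      r h x a + cumReward r (h + 1) τ := by
  rw [cumReward, Fin.sum_univ_succ, cumReward]
  simp [Nat.add_assoc, Nat.add_comm 1]

variable {S A : Type*} [Fintype S] [Fintype A]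

section Rollout

variable (P : Transition S A) (π : Policy S A)

theorem expect_rollout_succ (m h : ℕ) (x : S) (f : Segment S A (m + 1) → ℝ) :
    expect (rollout P π (m + 1) h x) f =
      expect (π h x) fun a => expect (P h x a) fun y =>
        expect (rollout P π m (h + 1) y) fun τ => f (Fin.cons (x, a, y) τ) := by
  simp only [rollout, expect_bind, expect_map]

/-- The value of `π` with `m` steps to go, starting in `x` at step `h`. -/
noncomputable def valueFrom (r : Reward S A) (m h : ℕ) (x : S) : ℝ :=
  expect (rollout P π m h x) (cumReward r h)

theorem value_eq_valueFrom (H : ℕ) (r : Reward S A) (x : S) :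
    value H P r π x = valueFrom P π r H 0 x := rfl

theorem valueFrom_zero (r : Reward S A) (h : ℕ) (x : S) : valueFrom P π r 0 h x = 0 := by
  simp [valueFrom, rollout, expect_pure, cumReward]

theorem valueFrom_succ (r : Reward S A) (m h : ℕ) (x : S) :
    valueFrom P π r (m + 1) h x =
      expect (π h x) fun a => r h x a + expect (P h x a) (valueFrom P π r m (h + 1)) := by
  rw [valueFrom, expect_rollout_succ]
  refine congrArg _ (funext fun a => ?_)
  simp only [cumReward_cons, expect_add, expect_const]
  rfl

theorem valueFrom_mem_Icc {r : Reward S A} (hr : r.IsUnit) (m h : ℕ) (x : S) :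
    valueFrom P π r m h x ∈ Set.Icc (0 : ℝ) m := by
  induction m generalizing h x with
  | zero => simp [valueFrom_zero]
  | succ m ih =>
    rw [valueFrom_succ]
    constructor
    · exact le_expect _ fun a => add_nonneg (hr h x a).1 (le_expect _ fun y => (ih _ y).1)
    · push_cast
      exact expect_le _ fun a => by
        linarith [(hr h x a).2, expect_le (P h x a) fun y => (ih (h + 1) y).2]

/-- Products of one-step factors of conditional mean at most `1` have mean at most `1`. -/
theorem expect_rollout_prod_le_one {z : ℕ → S → A → S → ℝ} (hz : ∀ h x a y, 0 ≤ z h x a y)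
    (hz1 : ∀ h x a, expect (P h x a) (z h x a) ≤ 1) (m h : ℕ) (x : S) :
    expect (rollout P π m h x)
      (fun τ => ∏ i : Fin m, z (h + i) (τ i).1 (τ i).2.1 (τ i).2.2) ≤ 1 := by
  induction m generalizing h x with
  | zero => simp [expect_const]
  | succ m ih =>
    rw [expect_rollout_succ]
    refine expect_le _ fun a => le_trans (expect_mono _ fun y => ?_) (hz1 h x a)
    simp only [Fin.prod_univ_succ, Fin.cons_zero, Fin.cons_succ, expect_mul_left, Fin.val_zero,
      add_zero, Fin.val_succ]
    refine mul_le_of_le_one_right (hz _ _ _ _) ?_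
    simpa only [Nat.add_assoc, Nat.add_comm 1] using ih (h + 1) y

/-- The exponential supermartingale of the accumulated differences `g` between a bounded function `U`
and its conditional expectation at the next step, along a rollout of a policy for which `g` is the
drift of `U`. -/
theorem expect_rollout_exp_le_one {U : ℕ → S → ℝ} {g : ℕ → S → A → ℝ} {N : ℕ} {B : ℝ}
    (hU : ∀ h x, U h x ∈ Set.Icc 0 B) (hUN : ∀ x, U N x = 0) {act : ℕ → S → A}
    (hact : ∀ h, h < N → ∀ x, U h x = g h x (act h x) + expect (P h x (act h x)) (U (h + 1)))
    (l : ℝ) (m h : ℕ) (hm : h + m = N) (x : S) :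
    expect (rollout P (fun h x => PMF.pure (act h x)) m h x)
      (fun τ => Real.exp (l * (U h x - ∑ i : Fin m, g (h + i) (τ i).1 (τ i).2.1)
        - l ^ 2 * B ^ 2 / 8 * m)) ≤ 1 := by
  induction m generalizing h x with
  | zero =>
    obtain rfl : h = N := by omega
    simp [expect_const, hUN]
  | succ m ih =>
    rw [expect_rollout_succ, expect_pure]
    set a := act h x with ha
    -- By the recursion for `U`, one step changes `U - ∑ g` by the conditional mean of `U (h + 1)`
    -- minus its realized value; the reversed sign is why Hoeffding's lemma is used at `-l`.
    have hstep : ∀ y, expect (rollout P (fun h x => PMF.pure (act h x)) m (h + 1) y)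
        (fun τ => Real.exp (l * (U h x - ∑ i : Fin (m + 1), g (h + i)
          ((Fin.cons (x, a, y) τ : Segment S A (m + 1)) i).1
          ((Fin.cons (x, a, y) τ : Segment S A (m + 1)) i).2.1)
          - l ^ 2 * B ^ 2 / 8 * (m + 1 : ℕ))) ≤
        Real.exp (-(l ^ 2 * B ^ 2 / 8)) *
          Real.exp ((-l) * (U (h + 1) y - expect (P h x a) (U (h + 1)))) := by
      intro y
      have h1 := ih (h + 1) (by omega) y
      rw [← mul_le_mul_iff_right₀ (Real.exp_pos (-(l ^ 2 * B ^ 2 / 8) +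
          (-l) * (U (h + 1) y - expect (P h x a) (U (h + 1))))), mul_one, ← expect_mul_left] at h1
      rw [← Real.exp_add]
      refine le_trans (le_of_eq ?_) h1
      refine congrArg _ (funext fun τ => ?_)
      rw [← Real.exp_add]
      congr 1
      simp only [Fin.sum_univ_succ, Fin.cons_zero, Fin.cons_succ, Fin.val_zero, add_zero,
        Fin.val_succ]
      rw [hact h (by omega) x, ← ha]
      have : ∀ i : Fin m, h + (i + 1 : ℕ) = h + 1 + i := fun i => by omega
      simp only [this]
      push_cast
      ring
    refine (expect_mono _ hstep).trans ?_
    rw [expect_mul_left]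
    refine (mul_le_mul_of_nonneg_left (expect_exp_le (P h x a) (U (h + 1)) (hU (h + 1)) (-l))
      (Real.exp_pos _).le).trans ?_
    rw [← Real.exp_add]
    exact (Real.exp_le_one_iff.2 (by ring_nf; rfl))

end Rollout

end PFUCB

/-! ### Visit counts and concentration of the empirical transitions. -/

namespace PFUCB

/-- Whether the data of step `i` enter the estimates for step `h`. -/
def Version.pools : Version → ℕ → ℕ → Bool
  | .stationary, _, _ => true
  | .nonstationary, h, i => decide (i = h)

/-- The transition law is one that the given version of the algorithm can estimate. -/
def Version.Admits {S A : Type*} (v : Version) (P : Transition S A) : Prop :=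
  ∀ h i, v.pools h i = true → P i = P h

/-- The data of the first `k` episodes. -/
def History.take {S A : Type*} {H K : ℕ} (D : History S A H K) (k : ℕ) (hk : k ≤ K) :
    History S A H k :=
  fun i => D (Fin.castLE hk i)

section Counts

variable {S A : Type*} [DecidableEq S] [DecidableEq A] {H k : ℕ}

theorem countNext_eq_sum (v : Version) (D : History S A H k) (h : ℕ) (x : S) (a : A) (y : S) :
    countNext v D h x a y =
      ∑ j, ∑ i : Fin H, if v.pools h i = true ∧ D j i = (x, a, y) then 1 else 0 := by
  cases v <;>
    simp only [countNext, Finset.card_filter, Fintype.sum_prod_type, Version.pools, true_and,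
      decide_eq_true_eq]

theorem sum_countNext (v : Version) (D : History S A H k) (h : ℕ) (x : S) (a : A)
    (B : Finset S) :
    ∑ y ∈ B, countNext v D h x a y = ∑ j, ∑ i : Fin H,
      if v.pools h i = true ∧ (D j i).1 = x ∧ (D j i).2.1 = a then
        (if (D j i).2.2 ∈ B then 1 else 0) else 0 := by
  simp only [countNext_eq_sum]
  rw [Finset.sum_comm]
  refine Finset.sum_congr rfl fun j _ => ?_
  rw [Finset.sum_comm]
  refine Finset.sum_congr rfl fun i _ => ?_
  by_cases h1 : v.pools h i = true ∧ (D j i).1 = x ∧ (D j i).2.1 = a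
  · obtain ⟨h1, h2, h3⟩ := h1
    simp [h1, ← h2, ← h3, Prod.ext_iff]
  · rw [if_neg h1]
    refine Finset.sum_eq_zero fun y _ => if_neg fun h2 => h1 ?_
    simp [h2.1, h2.2]

variable [Fintype S]

theorem count_eq_sum (v : Version) (D : History S A H k) (h : ℕ) (x : S) (a : A) :
    count v D h x a = ∑ j, ∑ i : Fin H,
      if v.pools h i = true ∧ (D j i).1 = x ∧ (D j i).2.1 = a then 1 else 0 := by
  rw [count, sum_countNext]
  simp

theorem count_le (v : Version) (D : History S A H k) (h : ℕ) (x : S) (a : A) :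
    count v D h x a ≤ k * H := by
  rw [count_eq_sum]
  calc _ ≤ ∑ _j : Fin k, ∑ _i : Fin H, 1 :=
        Finset.sum_le_sum fun j _ => Finset.sum_le_sum fun i _ => by split_ifs <;> simp
    _ = k * H := by simp

theorem empTrans_nonneg (v : Version) (D : History S A H k) (h : ℕ) (x : S) (a : A) (y : S) :
    0 ≤ empTrans v D h x a y := by
  unfold empTrans
  split_ifs <;> positivity

theorem empTrans_of_pos {v : Version} {D : History S A H k} {h : ℕ} {x : S} {a : A}
    (hn : 0 < count v D h x a) (y : S) :
    empTrans v D h x a y = countNext v D h x a y / count v D h x a := if_pos hn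

theorem sum_empTrans {v : Version} {D : History S A H k} {h : ℕ} {x : S} {a : A}
    (hn : 0 < count v D h x a) : ∑ y, empTrans v D h x a y = 1 := by
  simp only [empTrans_of_pos hn, ← Finset.sum_div]
  rw [← Nat.cast_sum, ← count, div_self]
  exact_mod_cast hn.ne'

/-- The empirical transition probabilities of all visited pairs exceed the true ones by at most
`√(ρ / (2 n))` on every set of states. -/
def Concentrated (v : Version) (P : Transition S A) (D : History S A H k) (ρ : ℝ) : Prop :=
  ∀ h < H, ∀ x a (B : Finset S), 0 < count v D h x a →
    ∑ y ∈ B, empTrans v D h x a y - ∑ y ∈ B, (P h x a y).toReal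
      ≤ √(ρ / (2 * count v D h x a))

/-- Among functions with values in `[0, b]`, the difference of the two expectations is largest for
`b` times the indicator of the set where the empirical law exceeds the true one. Control on sets
thus gives control on functions. -/
theorem Concentrated.sub_le {v : Version} {P : Transition S A} {D : History S A H k} {ρ : ℝ}
    (hc : Concentrated v P D ρ) {h : ℕ} (hh : h < H) {x : S} {a : A}
    (hn : 0 < count v D h x a) {V : S → ℝ} {b : ℝ} (hb : 0 ≤ b) (hV : ∀ y, V y ∈ Set.Icc 0 b) :
    ∑ y, empTrans v D h x a y * V y - expect (P h x a) V
      ≤ b * √(ρ / (2 * count v D h x a)) := by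
  classical
  set B := Finset.univ.filter fun y => (P h x a y).toReal < empTrans v D h x a y
  refine le_trans ?_ (mul_le_mul_of_nonneg_left (hc h hh x a B hn) hb)
  rw [expect, ← Finset.sum_sub_distrib, ← Finset.sum_sub_distrib, Finset.mul_sum,
    Finset.sum_filter]
  refine Finset.sum_le_sum fun y _ => ?_
  rw [← sub_mul]
  split_ifs with hy
  · rw [mul_comm]
    exact mul_le_mul_of_nonneg_right (hV y).2 (by linarith)
  · exact mul_nonpos_of_nonpos_of_nonneg (by linarith) (hV y).1

/-- The missing direction is the one-sided bound for `b - V`, both laws having total mass 1 at a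
visited pair. -/
theorem Concentrated.abs_sub_le {v : Version} {P : Transition S A} {D : History S A H k} {ρ : ℝ}
    (hc : Concentrated v P D ρ) {h : ℕ} (hh : h < H) {x : S} {a : A}
    (hn : 0 < count v D h x a) {V : S → ℝ} {b : ℝ} (hb : 0 ≤ b) (hV : ∀ y, V y ∈ Set.Icc 0 b) :
    |∑ y, empTrans v D h x a y * V y - expect (P h x a) V|
      ≤ b * √(ρ / (2 * count v D h x a)) := by
  refine abs_le.2 ⟨?_, hc.sub_le hh hn hb hV⟩
  have h1 := hc.sub_le hh hn (V := fun y => b - V y) hb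
    fun y => ⟨by linarith [(hV y).2], by linarith [(hV y).1]⟩
  have h2 : expect (P h x a) (fun y => b - V y) = b - expect (P h x a) V := by
    simp [expect, mul_sub, ← Finset.sum_mul, sum_toReal]
  have h3 : ∑ y, empTrans v D h x a y * (b - V y) = b - ∑ y, empTrans v D h x a y * V y := by
    simp [mul_sub, ← Finset.sum_mul, sum_empTrans hn]
  rw [h2, h3] at h1
  linarith

end Counts

/-! ### Martingale arguments across episodes of the exploration phase. -/

section Exploration

variable {S A : Type*} [Fintype S] [Fintype A] [DecidableEq S] [DecidableEq A] [Nonempty A]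
  (g : ArgmaxRule A) (v : Version) (d H L : ℕ) (δ : ℝ) (P : Transition S A) (x₁ : S)

theorem expect_exploreLaw_succ (k : ℕ) (f : History S A H (k + 1) → ℝ) :
    expect (exploreLaw g v d H L δ P x₁ (k + 1)) f =
      expect (exploreLaw g v d H L δ P x₁ k) fun D =>
        expect (rollout P (greedy g v D (exploreBonus S A d H L δ) 0) H 0 x₁)
          fun τ => f (Fin.snoc D τ) := by
  simp only [exploreLaw, expect_bind, expect_map]

/-- Later episodes do not change the law of the earlier ones, since the bonus parameter `L` is fixed
separately from the number of episodes. This transfers bounds for prefixes to the full run in the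
union bound. -/
theorem expect_exploreLaw_take {k K : ℕ} (hk : k ≤ K) (f : History S A H k → ℝ) :
    expect (exploreLaw g v d H L δ P x₁ K) (fun D => f (D.take k hk)) =
      expect (exploreLaw g v d H L δ P x₁ k) f := by
  induction K, hk using Nat.le_induction with
  | base => rfl
  | succ K hk ih =>
    rw [expect_exploreLaw_succ, ← ih]
    refine congrArg _ (funext fun D => ?_)
    have : ∀ τ : Segment S A H, History.take (Fin.snoc D τ : History S A H (K + 1)) k
        (Nat.le_succ_of_le hk) = D.take k hk := fun τ => funext fun i =>
      Fin.snoc_castSucc (α := fun _ => Segment S A H) τ D (Fin.castLE hk i)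
    simp only [this, expect_const]

/-- Given the earlier data, the last episode is a rollout of a policy determined by them, so its
factor has conditional mean at most 1 and can be peeled off. -/
theorem expect_exploreLaw_prod_le_one {ψ : (k : ℕ) → History S A H k → Segment S A H → ℝ}
    (hψ : ∀ k D τ, 0 ≤ ψ k D τ)
    (hψ1 : ∀ k (D : History S A H k),
      expect (rollout P (greedy g v D (exploreBonus S A d H L δ) 0) H 0 x₁) (ψ k D) ≤ 1)
    (K : ℕ) :
    expect (exploreLaw g v d H L δ P x₁ K)
      (fun D => ∏ k : Fin K, ψ k (D.take k k.isLt.le) (D k)) ≤ 1 := by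
  induction K with
  | zero => simp [expect_const]
  | succ K ih =>
    rw [expect_exploreLaw_succ]
    refine (expect_mono _ fun D => ?_).trans ih
    have h1 : ∀ (τ : Segment S A H) (k : Fin K),
        History.take (Fin.snoc D τ : History S A H (K + 1)) (k : ℕ) (k.isLt.le.trans K.le_succ) =
          D.take k k.isLt.le := fun τ k => funext fun i =>
      Fin.snoc_castSucc (α := fun _ => Segment S A H) τ D (Fin.castLE k.isLt.le i)
    have h2 : ∀ (τ : Segment S A H),
        History.take (Fin.snoc D τ : History S A H (K + 1)) K K.le_succ = D := fun τ =>
      funext fun i => Fin.snoc_castSucc (α := fun _ => Segment S A H) τ D i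
    simp only [Fin.prod_univ_castSucc, Fin.snoc_castSucc, Fin.snoc_last, Fin.val_castSucc,
      Fin.val_last, h1, h2, expect_mul_left]
    exact mul_le_of_le_one_right (Finset.prod_nonneg fun _ _ => hψ _ _ _) (hψ1 K D)

variable {v P}

/-- The exponential supermartingale of the number of transitions from a given pair into a given set. -/
theorem expect_exploreLaw_exp_count_le_one (hP : v.Admits P) (h : ℕ) (x : S) (a : A)
    (B : Finset S) (l : ℝ) (K : ℕ) :
    expect (exploreLaw g v d H L δ P x₁ K) (fun D =>
      Real.exp (l * (((∑ y ∈ B, countNext v D h x a y : ℕ) : ℝ) -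
        count v D h x a * ∑ y ∈ B, (P h x a y).toReal) - l ^ 2 / 8 * count v D h x a)) ≤ 1 := by
  classical
  set p := ∑ y ∈ B, (P h x a y).toReal with hp
  -- Only transitions from `(x, a)` at pooled steps contribute a nontrivial factor, so the
  -- compensator is `l ^ 2 / 8` per visit and the random count appears in the exponent without any
  -- stopping times.
  set z : ℕ → S → A → S → ℝ := fun i x' a' y =>
    if v.pools h i = true ∧ x' = x ∧ a' = a then
      Real.exp (l * ((if y ∈ B then 1 else 0) - p) - l ^ 2 / 8) else 1 with hz
  have hz0 : ∀ i x' a' y, 0 ≤ z i x' a' y := fun i x' a' y => by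
    simp only [hz]; split_ifs <;> positivity
  have hz1 : ∀ i x' a', expect (P i x' a') (z i x' a') ≤ 1 := by
    intro i x' a'
    by_cases hi : v.pools h i = true ∧ x' = x ∧ a' = a
    · have hPi := hP h i hi.1
      obtain ⟨h1, rfl, rfl⟩ := hi
      rw [hPi]
      simp only [hz, h1, if_true, sub_eq_add_neg, Real.exp_add, and_self]
      have h2 := expect_exp_le (P h x' a') (fun y => if y ∈ B then (1 : ℝ) else 0) (a := 0) (b := 1)
        (fun y => by split_ifs <;> simp) l
      have h3 : expect (P h x' a') (fun y => if y ∈ B then (1 : ℝ) else 0) = p := by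
        simp [expect, hp]
      rw [h3] at h2
      simp only [mul_comm _ (Real.exp (-(l ^ 2 / 8))), expect_mul_left]
      refine (mul_le_mul_of_nonneg_left h2 (Real.exp_pos _).le).trans ?_
      rw [← Real.exp_add]
      exact Real.exp_le_one_iff.2 (by ring_nf; rfl)
    · simp only [hz, if_neg hi, expect_const, le_refl]
  refine le_trans (le_of_eq ?_) (expect_exploreLaw_prod_le_one g v d H L δ P x₁
    (ψ := fun _ _ τ => ∏ i : Fin H, z (0 + i) (τ i).1 (τ i).2.1 (τ i).2.2)
    (fun _ _ τ => Finset.prod_nonneg fun i _ => hz0 _ _ _ _)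
    (fun k D => expect_rollout_prod_le_one P _ hz0 hz1 H 0 x₁) K)
  refine congrArg _ (funext fun D => ?_)
  have h4 : ∀ (j : Fin K) (i : Fin H), z (0 + i) (D j i).1 (D j i).2.1 (D j i).2.2 =
      Real.exp (l * ((if v.pools h i = true ∧ (D j i).1 = x ∧ (D j i).2.1 = a then
          (if (D j i).2.2 ∈ B then 1 else 0) else 0) -
        (if v.pools h i = true ∧ (D j i).1 = x ∧ (D j i).2.1 = a then 1 else 0) * p) -
        l ^ 2 / 8 * (if v.pools h i = true ∧ (D j i).1 = x ∧ (D j i).2.1 = a then 1 else 0)) := by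
    intro j i
    simp only [hz, zero_add]
    by_cases hi : v.pools h i = true ∧ (D j i).1 = x ∧ (D j i).2.1 = a
    · simp [if_pos hi]
    · simp only [if_neg hi]; simp
  simp only [h4, ← Real.exp_sum]
  congr 1
  rw [sum_countNext, count_eq_sum]
  push_cast
  simp only [Finset.sum_sub_distrib, ← Finset.mul_sum, ← Finset.sum_mul]

/-- Outside of an event of exponential moment at most `exp (-ρ)` per choice of the parameters, the
empirical transition probabilities are concentrated. -/
theorem exists_concentrated (hP : v.Admits P) (K : ℕ) {ρ : ℝ} (hρ : 0 ≤ ρ) :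
    ∃ f : History S A H K → ℝ, (∀ D, 0 ≤ f D) ∧
      expect (exploreLaw g v d H L δ P x₁ K) f ≤
        H * K * Fintype.card S * Fintype.card A * 2 ^ Fintype.card S * (H * K) * Real.exp (-ρ) ∧
      ∀ D, f D < 1 → ∀ k (hk : k < K), Concentrated v P (D.take k hk.le) ρ := by
  classical
  -- This is the maximizer of `l * t - l ^ 2 * n / 8` for `t = √(ρ * n / 2)`, with maximum `ρ`. It
  -- depends on the count, which is random, so the union bound also runs over all possible counts
  -- `1, …, H * K`, indexed from 0.
  let l : ℕ → ℝ := fun n => 4 * √(ρ * n / 2) / n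
  let F : (q : Fin H × Fin K × S × A × Finset S × Fin (H * K)) → History S A H q.2.1 → ℝ :=
    fun q D => Real.exp (l (q.2.2.2.2.2 + 1) * (((∑ y ∈ q.2.2.2.2.1,
        countNext v D q.1 q.2.2.1 q.2.2.2.1 y : ℕ) : ℝ) -
      count v D q.1 q.2.2.1 q.2.2.2.1 * ∑ y ∈ q.2.2.2.2.1, (P q.1 q.2.2.1 q.2.2.2.1 y).toReal) -
      l (q.2.2.2.2.2 + 1) ^ 2 / 8 * count v D q.1 q.2.2.1 q.2.2.2.1)
  refine ⟨fun D => ∑ q, Real.exp (-ρ) * F q (D.take q.2.1 q.2.1.isLt.le), fun D => ?_, ?_, ?_⟩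
  · exact Finset.sum_nonneg fun q _ => by positivity
  · rw [expect_sum]
    refine (Finset.sum_le_sum (g := fun _ => Real.exp (-ρ)) fun q _ => ?_).trans (le_of_eq ?_)
    · rw [expect_mul_left]
      refine mul_le_of_le_one_right (Real.exp_pos _).le ?_
      rw [expect_exploreLaw_take g v d H L δ P x₁ q.2.1.isLt.le (F q)]
      exact expect_exploreLaw_exp_count_le_one g d H L δ x₁ hP _ _ _ _ _ _
    · simp only [Finset.sum_const, Finset.card_univ, Fintype.card_prod, Fintype.card_fin,
        Fintype.card_finset, nsmul_eq_mul]
      push_cast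
      ring
  · intro D hD k hk h hh x a B hn
    by_contra! hlt
    refine hD.not_ge ?_
    set n := count v (D.take k hk.le) h x a with hn_def
    have hnle : n ≤ H * K := (count_le _ _ _ _ _).trans (by rw [mul_comm]; gcongr)
    have hn0 : (0 : ℝ) < n := by exact_mod_cast hn
    let q : Fin H × Fin K × S × A × Finset S × Fin (H * K) :=
      (⟨h, hh⟩, ⟨k, hk⟩, x, a, B, ⟨n - 1, by omega⟩)
    refine le_trans ?_ (Finset.single_le_sum (f := fun q =>
      Real.exp (-ρ) * F q (D.take q.2.1 q.2.1.isLt.le)) (fun q _ => by positivity)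
      (Finset.mem_univ q))
    have hq : (q.2.2.2.2.2 : ℕ) + 1 = n := by simp only [q]; omega
    simp only [F, ← Real.exp_add, hq]
    rw [Real.one_le_exp_iff]
    change 0 ≤ -ρ + (l n * (((∑ y ∈ B, countNext v (D.take k hk.le) h x a y : ℕ) : ℝ) -
      n * ∑ y ∈ B, (P h x a y).toReal) - l n ^ 2 / 8 * n)
    set p := ∑ y ∈ B, (P h x a y).toReal
    have h1 : √(ρ / (2 * n)) = √(ρ * n / 2) / n := by
      rw [← Real.sqrt_sq hn0.le, ← Real.sqrt_div' _ (sq_nonneg _), Real.sqrt_sq hn0.le]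
      congr 1
      field_simp
    simp only [empTrans_of_pos hn, ← Finset.sum_div] at hlt
    rw [← hn_def, h1, ← Nat.cast_sum] at hlt
    set c : ℝ := ((∑ y ∈ B, countNext v (D.take k hk.le) h x a y : ℕ) : ℝ)
    set t := √(ρ * n / 2) with ht
    have ht2 : t ^ 2 = ρ * n / 2 := Real.sq_sqrt (by positivity)
    have h2 : t ≤ c - n * p := by
      rw [div_lt_iff₀ hn0] at hlt
      have : (c / n - p) * n = c - n * p := by field_simp
      linarith
    have h3 : l n * t ≤ l n * (c - n * p) :=
      mul_le_mul_of_nonneg_left h2 (by simp only [l]; positivity)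
    have h4 : l n * t = 2 * ρ := by
      simp only [l, ← ht]
      rw [div_mul_eq_mul_div, mul_assoc, ← sq, ht2]
      field_simp; ring
    have h5 : l n ^ 2 / 8 * n = ρ := by
      simp only [l, ← ht]
      rw [div_pow, mul_pow, ht2]
      field_simp; ring
    linarith

end Exploration

end PFUCB

/-! ### Optimism, and domination of the planning error by exploration. -/

namespace PFUCB

section Planning

variable {S A : Type*} [Fintype S]

section Bonus

variable [Fintype A]

theorem planBonus_nonneg (d H L : ℕ) (δ : ℝ) (n : ℕ) : 0 ≤ planBonus S A d H L δ n := by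
  unfold planBonus; positivity

theorem two_mul_planBonus_le (d H L : ℕ) {δ : ℝ} (hι : 0 ≤ logFactor S A H L δ) (n : ℕ) :
    2 * planBonus S A d H L δ n ≤ exploreBonus S A d H L δ n :=
  le_add_of_nonneg_left (by positivity)

theorem exploreBonus_nonneg (d H L : ℕ) {δ : ℝ} (hι : 0 ≤ logFactor S A H L δ) (n : ℕ) :
    0 ≤ exploreBonus S A d H L δ n :=
  (mul_nonneg zero_le_two (planBonus_nonneg d H L δ n)).trans (two_mul_planBonus_le d H L hι n)

end Bonus

variable [DecidableEq S] [DecidableEq A] {H k : ℕ} {v : Version} {D : History S A H k}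

theorem ucbBackup_le (bonus : ℕ → ℝ) (r : Reward S A) (h : ℕ) (V : S → ℝ) (x : S) (a : A) :
    ucbBackup v D bonus r h V x a ≤ H := by
  unfold ucbBackup
  split_ifs
  · exact le_rfl
  · exact min_le_left _ _

theorem ucbBackup_nonneg {bonus : ℕ → ℝ} (hb : ∀ n, 0 ≤ bonus n) {r : Reward S A}
    (hr : ∀ h x a, 0 ≤ r h x a) (h : ℕ) {V : S → ℝ} (hV : ∀ y, 0 ≤ V y) (x : S) (a : A) :
    0 ≤ ucbBackup v D bonus r h V x a := by
  unfold ucbBackup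
  split_ifs
  · positivity
  · exact le_min (by positivity) (add_nonneg (add_nonneg (hr _ _ _) (hb _))
      (Finset.sum_nonneg fun y _ => mul_nonneg (empTrans_nonneg v D h x a y) (hV y)))

variable [Fintype A] {P : Transition S A} {d L : ℕ} {δ : ℝ}

/-- On concentrated data, the planning bonus dominates the estimation error of all value functions. -/
theorem Concentrated.abs_sub_le_planBonus
    (hc : Concentrated v P D (Fintype.card S * logFactor S A H L δ)) (hd : Fintype.card S ≤ d)
    {h : ℕ} (hh : h < H) {x : S} {a : A} (hn : 0 < count v D h x a) {V : S → ℝ}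
    (hV : ∀ y, V y ∈ Set.Icc (0 : ℝ) H) :
    |∑ y, empTrans v D h x a y * V y - expect (P h x a) V|
      ≤ planBonus S A d H L δ (count v D h x a) := by
  refine (hc.abs_sub_le hh hn (Nat.cast_nonneg H) hV).trans ?_
  rw [planBonus, min_eq_right hd]
  -- The square root in the bonus already equals `H * √(ρ / (2 n))` for `ρ = |S| ι_K`; the other
  -- summand is dropped.
  refine le_add_of_nonneg_of_le (by positivity) (le_of_eq ?_)
  nth_rw 1 [← Real.sqrt_sq (Nat.cast_nonneg (α := ℝ) H)]
  rw [← Real.sqrt_mul (sq_nonneg _)]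
  congr 1
  ring

variable [Nonempty A]

theorem ucbToGo_mem_Icc {bonus : ℕ → ℝ} (hb : ∀ n, 0 ≤ bonus n) {r : Reward S A}
    (hr : ∀ h x a, 0 ≤ r h x a) (m : ℕ) (x : S) :
    ucbToGo v D bonus r m x ∈ Set.Icc (0 : ℝ) H := by
  induction m generalizing x with
  | zero => simp [ucbToGo]
  | succ m ih =>
    refine ⟨?_, Finset.sup'_le _ _ fun a _ => ucbBackup_le _ _ _ _ _ _⟩
    obtain ⟨a⟩ := ‹Nonempty A›
    exact (ucbBackup_nonneg hb hr _ (fun y => (ih y).1) x a).trans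
      (Finset.le_sup' (f := fun a => ucbBackup v D bonus r (H - (m + 1))
        (ucbToGo v D bonus r m) x a) (Finset.mem_univ a))

theorem ucbBackup_le_ucbToGo (bonus : ℕ → ℝ) (r : Reward S A) {m h : ℕ} (hm : h + (m + 1) = H)
    (x : S) (a : A) :
    ucbBackup v D bonus r h (ucbToGo v D bonus r m) x a ≤ ucbToGo v D bonus r (m + 1) x := by
  obtain rfl : h = H - (m + 1) := by omega
  exact Finset.le_sup' (f := fun a => ucbBackup v D bonus r (H - (m + 1))
        (ucbToGo v D bonus r m) x a) (Finset.mem_univ a)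

theorem ucbToGo_succ_eq (g : ArgmaxRule A) (bonus : ℕ → ℝ) (r : Reward S A) {m h : ℕ}
    (hm : h + (m + 1) = H) (x : S) :
    ucbToGo v D bonus r (m + 1) x = ucbBackup v D bonus r h (ucbToGo v D bonus r m) x
      (g.pick (ucbQ v D bonus r h x)) := by
  refine le_antisymm ?_ (ucbBackup_le_ucbToGo bonus r hm x _)
  have hq : ∀ a, ucbQ v D bonus r h x a = ucbBackup v D bonus r h (ucbToGo v D bonus r m) x a := by
    intro a
    rw [ucbQ, show H - (h + 1) = m by omega]
  obtain rfl : h = H - (m + 1) := by omega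
  refine Finset.sup'_le _ _ fun a _ => ?_
  rw [← hq, ← hq]
  exact g.le_pick _ a

/-- Optimism of the planning phase. -/
theorem valueFrom_le_ucbToGo
    (hc : Concentrated v P D (Fintype.card S * logFactor S A H L δ)) (hd : Fintype.card S ≤ d)
    {r : Reward S A} (hr : r.IsUnit) (π : Policy S A) (m h : ℕ) (hm : h + m = H) (x : S) :
    valueFrom P π r m h x ≤ ucbToGo v D (planBonus S A d H L δ) r m x := by
  induction m generalizing h x with
  | zero => simp [valueFrom_zero, ucbToGo]
  | succ m ih =>
    rw [valueFrom_succ]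
    refine expect_le _ fun a => le_trans ?_ (ucbBackup_le_ucbToGo _ r hm x a)
    have hV := fun y => valueFrom_mem_Icc P π hr m (h + 1) y
    have hmH : (m : ℝ) + 1 ≤ H := by exact_mod_cast (by omega : m + 1 ≤ H)
    have h1 : r h x a + expect (P h x a) (valueFrom P π r m (h + 1)) ≤ H := by
      linarith [(hr h x a).2, expect_le (P h x a) fun y => (hV y).2]
    unfold ucbBackup
    split_ifs with hn
    · exact h1
    · refine le_min h1 ?_
      have h2 := abs_le.1 (hc.abs_sub_le_planBonus hd (by omega) (Nat.pos_of_ne_zero hn)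
        (V := valueFrom P π r m (h + 1)) fun y => ⟨(hV y).1, (hV y).2.trans (by linarith)⟩)
      have h3 : ∑ y, empTrans v D h x a y * valueFrom P π r m (h + 1) y ≤
          ∑ y, empTrans v D h x a y * ucbToGo v D (planBonus S A d H L δ) r m y :=
        Finset.sum_le_sum fun y _ => mul_le_mul_of_nonneg_left (ih (h + 1) (by omega) y)
          (empTrans_nonneg _ _ _ _ _ _)
      linarith [h2.1]

/-- The planning error is dominated by the optimistic value of the exploration phase. -/
theorem ucbToGo_sub_valueFrom_le
    (hc : Concentrated v P D (Fintype.card S * logFactor S A H L δ)) (hd : Fintype.card S ≤ d)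
    (hι : 0 ≤ logFactor S A H L δ) {r : Reward S A} (hr : r.IsUnit) (g : ArgmaxRule A)
    (m h : ℕ) (hm : h + m = H) (x : S) :
    ucbToGo v D (planBonus S A d H L δ) r m x -
      valueFrom P (greedy g v D (planBonus S A d H L δ) r) r m h x ≤
      ucbToGo v D (exploreBonus S A d H L δ) 0 m x := by
  set π := greedy g v D (planBonus S A d H L δ) r with hπ
  induction m generalizing h x with
  | zero => simp [valueFrom_zero, ucbToGo]
  | succ m ih =>
    have h0 := (valueFrom_mem_Icc P π hr (m + 1) h x).1
    rw [ucbToGo_succ_eq g _ r hm x]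
    -- Exploration maximizes over actions, so its estimate can be compared at the action the planner
    -- picks. There one planning bonus comes from the optimistic backup and a second from replacing
    -- the true transition law by the empirical one.
    refine le_trans ?_ (ucbBackup_le_ucbToGo _ 0 hm x
      (g.pick (ucbQ v D (planBonus S A d H L δ) r h x)))
    have h1 := ucbBackup_le (v := v) (D := D) (planBonus S A d H L δ) r h
      (ucbToGo v D (planBonus S A d H L δ) r m) x (g.pick (ucbQ v D (planBonus S A d H L δ) r h x))
    set a := g.pick (ucbQ v D (planBonus S A d H L δ) r h x)
    have hπx : valueFrom P π r (m + 1) h x =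
        r h x a + expect (P h x a) (valueFrom P π r m (h + 1)) := by
      rw [valueFrom_succ]
      exact expect_pure _ _
    rw [hπx] at h0 ⊢
    by_cases hn : count v D h x a = 0
    · rw [ucbBackup, ucbBackup, if_pos hn, if_pos hn]
      linarith
    · have hb := two_mul_planBonus_le (S := S) (A := A) d H L hι (count v D h x a)
      have hmH : (m : ℝ) + 1 ≤ H := by exact_mod_cast (by omega : m + 1 ≤ H)
      have hV := fun y => valueFrom_mem_Icc P π hr m (h + 1) y
      have h2 := abs_le.1 (hc.abs_sub_le_planBonus hd (by omega) (Nat.pos_of_ne_zero hn)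
        (V := valueFrom P π r m (h + 1)) fun y => ⟨(hV y).1, (hV y).2.trans (by linarith)⟩)
      have h3 : ∑ y, empTrans v D h x a y * ucbToGo v D (planBonus S A d H L δ) r m y -
          ∑ y, empTrans v D h x a y * valueFrom P π r m (h + 1) y ≤
          ∑ y, empTrans v D h x a y * ucbToGo v D (exploreBonus S A d H L δ) 0 m y := by
        rw [← Finset.sum_sub_distrib]
        refine Finset.sum_le_sum fun y _ => ?_
        rw [← mul_sub]
        exact mul_le_mul_of_nonneg_left (ih (h + 1) (by omega) y) (empTrans_nonneg _ _ _ _ _ _)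
      refine le_trans ?_ (le_of_eq (if_neg hn).symm)
      refine le_min (by linarith) ?_
      have h4 : ucbBackup v D (planBonus S A d H L δ) r h
          (ucbToGo v D (planBonus S A d H L δ) r m) x a ≤
          r h x a + planBonus S A d H L δ (count v D h x a) +
          ∑ y, empTrans v D h x a y * ucbToGo v D (planBonus S A d H L δ) r m y := by
        rw [ucbBackup, if_neg hn]; exact min_le_right _ _
      simp only [Pi.zero_apply]
      linarith [h2.1]

/-! ### Drifts of the exploration values, and their martingale bound. -/

/-- The excess of the optimistic exploration value at a pair over its expectation at the next step. -/
noncomputable def drift (v : Version) (P : Transition S A) (d L : ℕ) (δ : ℝ) {H k : ℕ}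
    (D : History S A H k) (h : ℕ) (x : S) (a : A) : ℝ :=
  ucbBackup v D (exploreBonus S A d H L δ) 0 h
      (ucbToGo v D (exploreBonus S A d H L δ) 0 (H - (h + 1))) x a -
    expect (P h x a) (ucbToGo v D (exploreBonus S A d H L δ) 0 (H - (h + 1)))

/-- A bound on the drift at a pair visited `n` times. -/
noncomputable def driftBound (S A : Type*) [Fintype S] [Fintype A] (d H L : ℕ) (δ : ℝ) (n : ℕ) : ℝ :=
  if n = 0 then (H : ℝ)
  else min (H : ℝ) (exploreBonus S A d H L δ n + planBonus S A d H L δ n)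

/-- The exploration estimates lie in `[0, H]`, so concentration applies to them as well: replacing
the empirical law by the true one costs a planning bonus on top of the exploration bonus. The bound
`H` comes from truncation and covers unvisited pairs. -/
theorem drift_le (hc : Concentrated v P D (Fintype.card S * logFactor S A H L δ))
    (hd : Fintype.card S ≤ d) (hι : 0 ≤ logFactor S A H L δ) {h : ℕ} (hh : h < H) (x : S) (a : A) :
    drift v P d L δ D h x a ≤ driftBound S A d H L δ (count v D h x a) := by
  have hU := ucbToGo_mem_Icc (v := v) (D := D) (exploreBonus_nonneg (S := S) (A := A) d H L hι)
    (r := 0) (fun _ _ _ => le_rfl) (H - (h + 1))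
  have h0 := le_expect (P h x a) fun y => (hU y).1
  have h1 := ucbBackup_le (v := v) (D := D) (exploreBonus S A d H L δ) 0 h
    (ucbToGo v D (exploreBonus S A d H L δ) 0 (H - (h + 1))) x a
  unfold drift driftBound
  split_ifs with hn
  · linarith
  · refine le_min (by linarith) ?_
    have h2 := abs_le.1 (hc.abs_sub_le_planBonus hd hh (Nat.pos_of_ne_zero hn) hU)
    rw [ucbBackup, if_neg hn]
    have h3 := min_le_right (H : ℝ) ((0 : Reward S A) h x a +
      exploreBonus S A d H L δ (count v D h x a) + ∑ y, empTrans v D h x a y *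
        ucbToGo v D (exploreBonus S A d H L δ) 0 (H - (h + 1)) y)
    simp only [Pi.zero_apply] at h3 ⊢
    linarith [h2.2]

/-- The exploration values are controlled by the drifts along the trajectories, up to an event of
probability at most `η`. -/
theorem exists_sum_ucbToGo_le (g : ArgmaxRule A) (v : Version) (P : Transition S A) (x₁ : S)
    (d H L : ℕ) (hι : 0 ≤ logFactor S A H L δ) {η : ℝ} (hη : 0 < η) (hη1 : η ≤ 1) {K : ℕ} :
    ∃ f : History S A H K → ℝ, (∀ D, 0 ≤ f D) ∧ expect (exploreLaw g v d H L δ P x₁ K) f ≤ η ∧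
      ∀ D, f D < 1 →
        ∑ k : Fin K, ucbToGo v (D.take k k.isLt.le) (exploreBonus S A d H L δ) 0 H x₁ ≤
          ∑ k : Fin K, ∑ i : Fin H,
            drift v P d L δ (D.take k k.isLt.le) i (D k i).1 (D k i).2.1 +
          √((H : ℝ) ^ 3 * K * Real.log (1 / η)) := by
  set w := Real.log (1 / η) with hw
  have hw0 : 0 ≤ w := Real.log_nonneg (by rw [le_div_iff₀ hη]; linarith)
  set T := (H : ℝ) ^ 3 * K with hT
  have hT0 : 0 ≤ T := by positivity
  -- The exponent chosen below divides by `T`; without steps or without episodes both sides are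
  -- trivial.
  by_cases hTz : T = 0
  · refine ⟨0, fun _ => le_rfl, by simpa [expect] using hη.le, fun D _ => ?_⟩
    rcases mul_eq_zero.1 hTz with h | h
    · have : H = 0 := by simpa using h
      subst this
      simp [ucbToGo]
    · have : K = 0 := by exact_mod_cast h
      subst this
      simp
  have hTpos : 0 < T := lt_of_le_of_ne hT0 (Ne.symm hTz)
  -- Here the exponent would vanish and carry no information, but `η = 1`, so the whole space may be
  -- declared a failure.
  by_cases hwz : w = 0
  · refine ⟨fun _ => 1, fun _ => zero_le_one, ?_, fun D hD => (lt_irrefl _ hD).elim⟩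
    rw [expect_const]
    have : 1 / η = 1 := by
      rw [← Real.exp_log (show 0 < 1 / η by positivity), ← hw, hwz, Real.exp_zero]
    rw [div_eq_one_iff_eq hη.ne'] at this
    exact this.le
  have hwpos : 0 < w := lt_of_le_of_ne hw0 (Ne.symm hwz)
  -- Optimizing over the exponent would replace `T * w` by `T * w / 2`.
  set l := √(w / T) * 2 with hl
  have hlpos : 0 < l := by positivity
  have hl2 : l ^ 2 * T = 4 * w := by
    rw [hl, mul_pow, Real.sq_sqrt (by positivity)]
    field_simp
    norm_num
  have hlw : l * √(T * w) = 2 * w := by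
    rw [hl, mul_right_comm, ← Real.sqrt_mul (by positivity),
      show w / T * (T * w) = w ^ 2 by field_simp, Real.sqrt_sq hw0]
    ring
  let ψ : (k : ℕ) → History S A H k → Segment S A H → ℝ := fun k D τ =>
    Real.exp (l * (ucbToGo v D (exploreBonus S A d H L δ) 0 H x₁ -
      ∑ i : Fin H, drift v P d L δ D (0 + i) (τ i).1 (τ i).2.1) - l ^ 2 * (H : ℝ) ^ 2 / 8 * H)
  have hψ := expect_exploreLaw_prod_le_one g v d H L δ P x₁ (ψ := ψ)
    (fun _ _ _ => (Real.exp_pos _).le) (fun k D => by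
      have h1 := expect_rollout_exp_le_one P
        (U := fun h => ucbToGo v D (exploreBonus S A d H L δ) 0 (H - h))
        (g := drift v P d L δ D) (N := H) (B := H)
        (fun h x => ucbToGo_mem_Icc (exploreBonus_nonneg d H L hι) (fun _ _ _ => le_rfl) _ x)
        (fun x => by simp [ucbToGo])
        (act := fun h x => g.pick (ucbQ v D (exploreBonus S A d H L δ) 0 h x))
        (fun h hh x => by
          rw [drift, sub_add_cancel, ← ucbToGo_succ_eq g _ _ (by omega) x]
          congr 1
          omega)
        l H 0 (zero_add H) x₁
      exact h1) K
  refine ⟨fun D => η * ∏ k : Fin K, ψ k (D.take k k.isLt.le) (D k), fun D => ?_, ?_, fun D hD => ?_⟩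
  · exact mul_nonneg hη.le (Finset.prod_nonneg fun _ _ => (Real.exp_pos _).le)
  · rw [expect_mul_left]
    exact mul_le_of_le_one_right hη.le hψ
  · simp only [ψ, ← Real.exp_sum, zero_add] at hD
    nth_rw 1 [← Real.exp_log hη] at hD
    rw [← Real.exp_add, Real.exp_lt_one_iff, Finset.sum_sub_distrib, ← Finset.mul_sum,
      Finset.sum_sub_distrib] at hD
    have h1 : Real.log η = -w := by rw [hw, one_div, Real.log_inv, neg_neg]
    have h2 : ∑ _k : Fin K, l ^ 2 * (H : ℝ) ^ 2 / 8 * H = w / 2 := by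
      rw [Finset.sum_const, Finset.card_univ, Fintype.card_fin, nsmul_eq_mul]
      linear_combination hl2 / 8
    rw [h1, h2] at hD
    have h3 : l * (∑ k : Fin K, ucbToGo v (D.take k k.isLt.le) (exploreBonus S A d H L δ) 0 H x₁ -
        ∑ k : Fin K, ∑ i : Fin H, drift v P d L δ (D.take k k.isLt.le) i (D k i).1 (D k i).2.1) ≤
        l * √(T * w) := by linarith
    have h4 := le_of_mul_le_mul_left h3 hlpos
    linarith

end Planning

end PFUCB

/-! ### Pigeonhole bounds for sums of bonuses over visits. -/

namespace PFUCB

section Pigeonhole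

/-- Sums over repeated visits to finitely many cells, with weights depending on the number of visits
in earlier rounds, are controlled by a potential. -/
theorem sum_visits_le {Cell : Type*} [Fintype Cell] [DecidableEq Cell] {H K : ℕ}
    (q : Fin K → Fin H → Cell) {F Φ : ℕ → ℝ} (hΦ : Φ 0 = 0)
    (hF : ∀ N n, n ≤ H → n * F N ≤ Φ (N + n) - Φ N) :
    ∑ k : Fin K, ∑ i : Fin H, F (∑ j : Fin k, ∑ i' : Fin H,
        if q (Fin.castLE k.isLt.le j) i' = q k i then 1 else 0) ≤
      ∑ c, Φ (∑ j : Fin K, ∑ i : Fin H, if q j i = c then 1 else 0) := by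
  let n : ℕ → Cell → ℕ := fun j c =>
    if hj : j < K then ∑ i : Fin H, if q ⟨j, hj⟩ i = c then 1 else 0 else 0
  have hn : ∀ (j : ℕ) (hj : j < K) c,
      n j c = ∑ i : Fin H, if q ⟨j, hj⟩ i = c then 1 else 0 := fun j hj c => dif_pos hj
  have hnH : ∀ j c, n j c ≤ H := by
    intro j c
    by_cases hj : j < K
    · rw [hn j hj]
      calc _ ≤ ∑ _i : Fin H, 1 := Finset.sum_le_sum fun i _ => by split_ifs <;> simp
        _ = H := by simp
    · simp [n, hj]
  have hN : ∀ (k : ℕ) (hk : k ≤ K) c, ∑ j : Fin k, ∑ i' : Fin H,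
      (if q (Fin.castLE hk j) i' = c then 1 else 0) = ∑ j ∈ Finset.range k, n j c := by
    intro k hk c
    rw [Finset.sum_range]
    exact Finset.sum_congr rfl fun j _ => (hn j (j.isLt.trans_le hk) c).symm
  have h1 : ∀ k : Fin K, ∑ i : Fin H, F (∑ j : Fin k, ∑ i' : Fin H,
        if q (Fin.castLE k.isLt.le j) i' = q k i then 1 else 0) =
      ∑ c, (n k c : ℝ) * F (∑ j ∈ Finset.range k, n j c) := by
    intro k
    simp only [hN k k.isLt.le, hn k k.isLt]
    -- Counts are frozen during a round, so all visits to a cell in that round have the same weight.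
    rw [← Finset.sum_fiberwise Finset.univ (q k)]
    refine Finset.sum_congr rfl fun c _ => ?_
    rw [Finset.sum_congr rfl (g := fun _ => F (∑ j ∈ Finset.range k, n j c)) fun i hi => by
      rw [(Finset.mem_filter.1 hi).2], Finset.sum_const, nsmul_eq_mul, Finset.card_filter]
  simp only [h1]
  rw [Finset.sum_comm]
  refine Finset.sum_le_sum fun c _ => ?_
  have h2 := hN K le_rfl c
  simp only [Fin.castLE_rfl, id] at h2
  rw [h2, ← Finset.sum_range fun k => (n k c : ℝ) * F (∑ j ∈ Finset.range k, n j c)]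
  calc _ ≤ ∑ k ∈ Finset.range K,
        (Φ (∑ j ∈ Finset.range (k + 1), n j c) - Φ (∑ j ∈ Finset.range k, n j c)) :=
        Finset.sum_le_sum fun k _ => by
          rw [Finset.sum_range_succ _ k]
          exact hF _ _ (hnH k c)
    _ = _ := by
      rw [Finset.sum_range_sub (fun k => Φ (∑ j ∈ Finset.range k, n j c))]
      simp [hΦ]

/-- The potential of a truncated bonus of the form `γ + α / √N + β / N`. -/
noncomputable def potential (H : ℕ) (α β γ : ℝ) (N : ℕ) : ℝ :=
  H * min (N : ℝ) (2 * H) + 3 * α * √N + 2 * β * Real.log N + γ * N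

/-- Since counts are updated only between episodes, small counts are handled separately. While `N <
H`, the truncation at `H` is paid by the first term of the potential, which is still linear because
`N + n ≤ 2 * H`. Once `N ≥ H ≥ n`, the count at most doubles in an episode, so `n / √N` and `n / N`
are within factors 3 and 2 of the increments of `√` and `log`. -/
theorem mul_le_potential_sub {H : ℕ} {α β γ : ℝ} (hα : 0 ≤ α) (hβ : 0 ≤ β) (hγ : 0 ≤ γ)
    {F : ℕ → ℝ} (hFH : ∀ N, F N ≤ H) (hF : ∀ N, 0 < N → F N ≤ γ + α / √N + β / N)
    (N n : ℕ) (hn : n ≤ H) :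
    n * F N ≤ potential H α β γ (N + n) - potential H α β γ N := by
  have hn0 : (0 : ℝ) ≤ n := n.cast_nonneg
  have hN0 : (0 : ℝ) ≤ N := N.cast_nonneg
  have hnH : (n : ℝ) ≤ H := by exact_mod_cast hn
  have hs : √(N : ℝ) ≤ √((N + n : ℕ) : ℝ) := Real.sqrt_le_sqrt (by push_cast; linarith)
  have hmin : min (N : ℝ) (2 * H) ≤ min ((N + n : ℕ) : ℝ) (2 * H) :=
    min_le_min_right _ (by push_cast; linarith)
  have hγn : γ * ((N + n : ℕ) : ℝ) = γ * N + γ * n := by push_cast; ring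
  have hγ0 : 0 ≤ γ * n := by positivity
  unfold potential
  rw [hγn]
  by_cases hNH : N < H
  · have hNH' : (N : ℝ) ≤ H := by exact_mod_cast hNH.le
    have h1 : min ((N + n : ℕ) : ℝ) (2 * H) = N + n := by
      rw [min_eq_left] <;> push_cast <;> linarith
    have h2 : min (N : ℝ) (2 * H) = N := min_eq_left (by linarith)
    have hlog : Real.log (N : ℝ) ≤ Real.log ((N + n : ℕ) : ℝ) := by
      rcases Nat.eq_zero_or_pos N with rfl | hN
      · simp [Real.log_natCast_nonneg]
      · exact Real.log_le_log (by exact_mod_cast hN) (by push_cast; linarith)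
    have h3 := mul_le_mul_of_nonneg_left (hFH N) hn0
    have h4 := mul_le_mul_of_nonneg_left hs (by positivity : 0 ≤ 3 * α)
    have h5 := mul_le_mul_of_nonneg_left hlog (by positivity : 0 ≤ 2 * β)
    rw [h1, h2]
    nlinarith
  · rcases Nat.eq_zero_or_pos n with rfl | hnpos
    · simp
    have hNpos : 0 < N := by omega
    have hN : (0 : ℝ) < N := by exact_mod_cast hNpos
    have hnN : (n : ℝ) ≤ N := by exact_mod_cast (by omega : n ≤ N)
    have h1 := mul_le_mul_of_nonneg_left (hF N hNpos) hn0
    have h2 : (n : ℝ) / √N ≤ 3 * (√((N + n : ℕ) : ℝ) - √N) := by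
      set s := √(N : ℝ) with hs_def
      set t := √((N + n : ℕ) : ℝ) with ht_def
      have hs2 : s ^ 2 = N := Real.sq_sqrt hN0
      have ht2 : t ^ 2 = N + n := by rw [ht_def, Real.sq_sqrt (by positivity)]; push_cast; rfl
      have hspos : 0 < s := Real.sqrt_pos.2 hN
      have ht : t ≤ 2 * s := abs_le_of_sq_le_sq' (by nlinarith) (by positivity) |>.2
      rw [div_le_iff₀ hspos]
      nlinarith [mul_nonneg (sub_nonneg.2 hs) (sub_nonneg.2 ht)]
    have h3 : (n : ℝ) / N ≤ 2 * (Real.log ((N + n : ℕ) : ℝ) - Real.log N) := by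
      rw [← Real.log_div (by positivity) hN.ne']
      -- With `u = n / N ≤ 1` this reads `log (1 + u) ≥ u / (1 + u) ≥ u / 2`.
      have h4 := Real.one_sub_inv_le_log_of_pos (x := ((N + n : ℕ) : ℝ) / N) (by positivity)
      have h5 : (n : ℝ) / N / 2 ≤ 1 - (((N + n : ℕ) : ℝ) / N)⁻¹ := by
        push_cast
        rw [inv_div, div_div, one_sub_div (by positivity), add_sub_cancel_left]
        exact div_le_div_of_nonneg_left hn0 (by positivity) (by linarith)
      linarith
    have h6 := mul_le_mul_of_nonneg_left h2 hα
    have h7 := mul_le_mul_of_nonneg_left h3 hβ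
    have h8 := mul_le_mul_of_nonneg_left hmin (Nat.cast_nonneg (α := ℝ) H)
    have h9 : (n : ℝ) * (γ + α / √N + β / N) = γ * n + α * (n / √N) + β * (n / N) := by ring
    linarith

/-- Cauchy–Schwarz over the cells for the square roots; each logarithm is bounded by that of the
total. -/
theorem sum_potential_le {Cell : Type*} [Fintype Cell] {H T : ℕ} {α β γ : ℝ} (hα : 0 ≤ α)
    (hβ : 0 ≤ β) (N : Cell → ℕ) (hN : ∑ c, N c = T) :
    ∑ c, potential H α β γ (N c) ≤ Fintype.card Cell * (2 * H ^ 2) +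
      3 * α * √(Fintype.card Cell * T) + 2 * β * (Fintype.card Cell * Real.log T) + γ * T := by
  have h1 : ∑ c, √(N c : ℝ) ≤ √(Fintype.card Cell * T) := by
    refine Real.le_sqrt_of_sq_le ?_
    refine (sq_sum_le_card_mul_sum_sq (s := Finset.univ) (f := fun c => √(N c : ℝ))).trans
      (le_of_eq ?_)
    simp only [Real.sq_sqrt (Nat.cast_nonneg _)]
    rw [← hN]
    push_cast
    rfl
  have h2 : ∀ c, potential H α β γ (N c) ≤
      2 * H ^ 2 + 3 * α * √(N c : ℝ) + 2 * β * Real.log T + γ * N c := by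
    intro c
    have h3 := mul_le_mul_of_nonneg_left (min_le_right (N c : ℝ) (2 * H))
      (Nat.cast_nonneg (α := ℝ) H)
    have hle : N c ≤ T := hN ▸ Finset.single_le_sum (fun _ _ => Nat.zero_le _) (Finset.mem_univ c)
    have h4 : Real.log (N c) ≤ Real.log T := by
      rcases Nat.eq_zero_or_pos (N c) with h | h
      · simp [h, Real.log_natCast_nonneg]
      · exact Real.log_le_log (by exact_mod_cast h) (by exact_mod_cast hle)
    have h5 := mul_le_mul_of_nonneg_left h4 (by positivity : 0 ≤ 2 * β)
    unfold potential
    nlinarith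
  refine (Finset.sum_le_sum fun c _ => h2 c).trans ?_
  have h6 : ∑ c, (N c : ℝ) = T := by exact_mod_cast hN
  simp only [Finset.sum_add_distrib, Finset.sum_const, ← Finset.mul_sum, Finset.card_univ,
    nsmul_eq_mul, h6]
  have h7 := mul_le_mul_of_nonneg_left h1 (by positivity : 0 ≤ 3 * α)
  linarith

end Pigeonhole

/-! ### Comparison of the regret bound with the target accuracy. -/

section Numerics

/-- The logarithmic factor of a run of `K` episodes, for `K` a multiple of the sample complexity. -/
theorem log_factor_le {X W δ ε s K : ℝ} (hX : 2 ≤ X) (hW : 0 < W) (hWX : W ≤ X ^ 4) (hδ : 0 < δ)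
    (hδ1 : δ < 1) (hε : 0 < ε) (hε1 : ε < 1) (hs : 1 ≤ s)
    (hK : K * ε ^ 2 = s ^ 4 * (W * Real.log (X / (δ * ε)))) :
    Real.log (6 * X ^ 2 * K ^ 2 / δ) ≤ 16 * s * Real.log (X / (δ * ε)) := by
  set ι := Real.log (X / (δ * ε)) with hι
  have hX0 : 0 < X := by linarith
  have hlX : Real.log 2 ≤ Real.log X := Real.log_le_log two_pos hX
  have hlδ : Real.log δ ≤ 0 := Real.log_nonpos hδ.le hδ1.le
  have hlε : Real.log ε ≤ 0 := Real.log_nonpos hε.le hε1.le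
  have hι' : ι = Real.log X - Real.log δ - Real.log ε := by
    rw [hι, Real.log_div hX0.ne' (by positivity), Real.log_mul hδ.ne' hε.ne']
    ring
  have hl2 := Real.log_two_gt_d9
  have hιpos : 0 < ι := by linarith
  have hlι : Real.log ι ≤ ι - 1 := Real.log_le_sub_one_of_pos hιpos
  have hls : Real.log s ≤ s - 1 := Real.log_le_sub_one_of_pos (by linarith)
  have hlW : Real.log W ≤ 4 * Real.log X := by
    have := Real.log_le_log hW hWX
    rwa [Real.log_pow] at this
  have hKpos : 0 < K := by
    by_contra! h
    have h1 : 0 < s ^ 4 * (W * ι) := by positivity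
    nlinarith [mul_nonneg (neg_nonneg.2 h) (sq_nonneg ε)]
  have hlK : Real.log K + 2 * Real.log ε = 4 * Real.log s + (Real.log W + Real.log ι) := by
    have := congrArg Real.log hK
    rw [Real.log_mul hKpos.ne' (by positivity), Real.log_mul (by positivity) (by positivity),
      Real.log_mul hW.ne' hιpos.ne', Real.log_pow, Real.log_pow] at this
    exact_mod_cast this
  have hl6 : Real.log 6 ≤ 3 * Real.log 2 := by
    have h1 : Real.log 6 ≤ Real.log (2 ^ 3) := Real.log_le_log (by norm_num) (by norm_num)
    rw [Real.log_pow] at h1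
    exact_mod_cast h1
  rw [Real.log_div (by positivity) hδ.ne', Real.log_mul (by positivity) (by positivity),
    Real.log_mul (by norm_num) (by positivity), Real.log_pow, Real.log_pow]
  push_cast
  -- The excess sample factor `s ^ 4` enters `2 * log K` as `8 * log s ≤ 8 * (s - 1)`, and `ι ≥ log
  -- 2 > 1/2`.
  have h1 : 8 * (s - 1) ≤ 16 * ((s - 1) * ι) := by nlinarith
  linarith

/-- The final comparison of the regret bound with the target accuracy. -/
theorem regret_bound_le {W G H ε s ι I K : ℝ} (hG : 0 ≤ G) (hH : 0 < H) (hW : W = H * G)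
    (hε : 0 < ε) (hs : 100 ≤ s) (hι : 0 ≤ ι) (hI : 0 ≤ I) (hIs : I ≤ 16 * s * ι)
    (hιH : ε * ι ≤ H) (hK0 : 0 ≤ K) (hK : K * ε ^ 2 = s ^ 4 * (W * ι)) :
    10 * √(W * K * I) + 14 * (G * I ^ 2) ≤ ε * K := by
  have hs3 : 1000000 ≤ s ^ 3 := by
    have := pow_le_pow_left₀ (by norm_num) hs 3
    norm_num at this ⊢
    exact this
  have hs2 : 10000 ≤ s ^ 2 := by
    have := pow_le_pow_left₀ (by norm_num) hs 2
    norm_num at this ⊢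
    exact this
  have hW0 : 0 ≤ W := by rw [hW]; positivity
  -- Each of the two terms gets half of `ε * K`. With `I ≤ 16 * s * ι` this needs `6400 ≤ s ^ 3`
  -- here and `7168 ≤ s ^ 2` for the other term, both ensured by `100 ≤ s`.
  have h1 : √(W * K * I) ≤ ε * K / 20 := by
    refine Real.sqrt_le_iff.2 ⟨by positivity, ?_⟩
    have h2 : 400 * (W * I) ≤ K * ε ^ 2 := by
      have h3 : W * I ≤ W * (16 * s * ι) := mul_le_mul_of_nonneg_left hIs hW0
      have h4 : 6400 * (s * (W * ι)) ≤ s ^ 3 * (s * (W * ι)) :=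
        mul_le_mul_of_nonneg_right (by linarith) (by positivity)
      linear_combination 400 * h3 + h4 - hK
    have h5 := mul_le_mul_of_nonneg_left h2 hK0
    linear_combination h5 / 400
  have h6 : 14 * (G * I ^ 2) ≤ ε * K / 2 := by
    refine le_of_mul_le_mul_right ?_ hε
    have h7 : I ^ 2 ≤ (16 * s * ι) ^ 2 := pow_le_pow_left₀ hI hIs 2
    have h8 : ε * (G * I ^ 2) ≤ ε * (G * (16 * s * ι) ^ 2) := by gcongr
    -- The smallness of `ε` trades one logarithm for a factor `H`, turning `G` into `W`.
    have h9 : 256 * s ^ 2 * G * ι * (ε * ι) ≤ 256 * s ^ 2 * G * ι * H := by gcongr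
    have h10 : 7168 * (s ^ 2 * (G * ι * H)) ≤ s ^ 2 * (s ^ 2 * (G * ι * H)) :=
      mul_le_mul_of_nonneg_right (by linarith) (by positivity)
    rw [hW] at hK
    linear_combination 14 * h8 + 14 * h9 + h10 / 2 - hK / 2
  linarith

end Numerics

end PFUCB

/-! ### Assembly of the regret bound and the sample complexity. -/

namespace PFUCB

section Regret

/-- Used with `n = |S|` and `exp (-ι_K) = 1 / y`: since the deviation level is `|S| ι_K`, the `2 ^
n` subsets of states are absorbed into the `n`-th power. -/
theorem union_bound_le {H K s a y : ℝ} {n : ℕ} (hn : n ≠ 0) (hy : 2 ≤ y) (hsa : 0 ≤ s * a) :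
    H * K * s * a * 2 ^ n * (H * K) * (1 / y) ^ n ≤ (H * K) ^ 2 * (s * a) * (2 / y) := by
  have h1 : (2 / y) ^ n ≤ 2 / y :=
    pow_le_of_le_one (by positivity) (by rw [div_le_one (by linarith)]; exact hy) hn
  calc _ = (H * K) ^ 2 * (s * a) * (2 / y) ^ n := by
        rw [div_eq_mul_one_div 2 y, mul_pow]; ring
    _ ≤ _ := mul_le_mul_of_nonneg_left h1 (by positivity)

/-- The terms of the regret bound, compared with the two dominant ones. -/
theorem regret_terms_le {H s m I W K w T : ℝ} (hH1 : 1 ≤ H) (hS1 : 1 ≤ s) (hM1 : 1 ≤ m)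
    (hI1 : 1 ≤ I) (hK1 : 1 ≤ K) (hWdef : W = H ^ 3 * s * m) (hIδ : w ≤ I)
    (hIHK : T ≤ I) :
    m * (2 * H ^ 2) + 3 * (3 * √(s * H ^ 2 * I / 2)) * √(m * (K * H)) +
        2 * (3 * H ^ 2 * s * I) * (m * T) + 6 / K * (K * H) + √(H ^ 3 * K * w) ≤
      10 * √(W * K * I) + 14 * (H ^ 2 * s * m * I ^ 2) := by
  have hG1 : 1 ≤ s * m := one_le_mul_of_one_le_of_one_le hS1 hM1
  have hII : 1 ≤ I ^ 2 := one_le_pow₀ hI1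
  -- The constants are `10 = 9 + 1`, from the square-root bonuses and the martingale noise, and `14
  -- = 2 + 6 + 6`, from the burn-in, the `1 / N` bonuses and the constant part of the bonuses.
  have e1 : m * (2 * H ^ 2) ≤ 2 * (H ^ 2 * s * m * I ^ 2) := by
    have : H ^ 2 * m * 1 ≤ H ^ 2 * m * (s * I ^ 2) :=
      mul_le_mul_of_nonneg_left (one_le_mul_of_one_le_of_one_le hS1 hII) (by positivity)
    linarith
  have e2 : 3 * (3 * √(s * H ^ 2 * I / 2)) * √(m * (K * H)) ≤ 9 * √(W * K * I) := by
    rw [← mul_assoc, mul_assoc, ← Real.sqrt_mul (by positivity)]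
    norm_num only
    refine mul_le_mul_of_nonneg_left (Real.sqrt_le_sqrt ?_) (by norm_num)
    rw [hWdef]
    have : 0 ≤ H ^ 3 * s * m * K * I := by positivity
    linarith
  have e3 : 2 * (3 * H ^ 2 * s * I) * (m * T) ≤
      6 * (H ^ 2 * s * m * I ^ 2) := by
    have := mul_le_mul_of_nonneg_left hIHK (by positivity : 0 ≤ 6 * (H ^ 2 * s * m * I))
    linarith
  have e4 : 6 / K * (K * H) ≤ 6 * (H ^ 2 * s * m * I ^ 2) := by
    have h2 : 6 / K * (K * H) = 6 * H := by
        field_simp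
    have h3 : H ≤ H ^ 2 := le_self_pow₀ hH1 two_ne_zero
    have h4 : H ^ 2 * 1 ≤ H ^ 2 * (s * m * I ^ 2) :=
      mul_le_mul_of_nonneg_left (one_le_mul_of_one_le_of_one_le hG1 hII) (by positivity)
    linarith
  have e5 : √(H ^ 3 * K * w) ≤ √(W * K * I) := by
    refine Real.sqrt_le_sqrt ?_
    calc H ^ 3 * K * w ≤ H ^ 3 * K * I :=
          mul_le_mul_of_nonneg_left hIδ (by positivity)
      _ ≤ H ^ 3 * K * I * (s * m) := le_mul_of_one_le_right (by positivity) hG1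
      _ = W * K * I := by rw [hWdef]; ring
  linarith

variable {S A : Type*} [Fintype S] [Fintype A]

theorem driftBound_le (d H L : ℕ) (δ : ℝ) (n : ℕ) : driftBound S A d H L δ n ≤ H := by
  unfold driftBound
  split_ifs
  · exact le_rfl
  · exact min_le_left _ _

/-- The exploration bonus contains two planning bonuses and the estimation error adds a third, hence
the factor 3 and the constant `6 / L`. -/
theorem driftBound_le_of_pos {d : ℕ} (hd : Fintype.card S ≤ d) (H L : ℕ) (δ : ℝ) {n : ℕ}
    (hn : 0 < n) :
    driftBound S A d H L δ n ≤ 6 / L +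
      3 * √(Fintype.card S * (H : ℝ) ^ 2 * logFactor S A H L δ / 2) / √n +
      3 * (H : ℝ) ^ 2 * Fintype.card S * logFactor S A H L δ / n := by
  rw [driftBound, if_neg hn.ne']
  refine (min_le_right _ _).trans (le_of_eq ?_)
  rw [exploreBonus, planBonus, min_eq_right hd, ← div_div, Real.sqrt_div' _ n.cast_nonneg]
  ring

theorem logFactor_eq {H L : ℕ} (δ : ℝ) :
    logFactor S A H L δ =
      Real.log (6 * (H : ℝ) ^ 2 * Fintype.card S * Fintype.card A * (L : ℝ) ^ 2 / δ) := by
  rw [logFactor, mul_one_div, div_div_eq_mul_div]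
  ring_nf

variable [DecidableEq S] [DecidableEq A] [Nonempty A]

/-- On concentrated data along which the optimistic exploration values are controlled by their drifts,
the planned policies are near-optimal on average for all rewards. -/
theorem optValue_sub_uniformValue_le {v : Version} {P : Transition S A} (g : ArgmaxRule A)
    (x₁ : S) {d H L K : ℕ} {δ : ℝ} (hd : Fintype.card S ≤ d) (hK : 0 < K)
    (hι : 0 ≤ logFactor S A H L δ)
    {Cell : Type*} [Fintype Cell] [DecidableEq Cell] {cell : Fin H → S → A → Cell}
    (hcell : ∀ i x a i' x' a', cell i' x' a' = cell i x a ↔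
      v.pools i i' = true ∧ x' = x ∧ a' = a)
    {D : History S A H K}
    (hc : ∀ k (hk : k < K),
      Concentrated v P (D.take k hk.le) (Fintype.card S * logFactor S A H L δ))
    {η : ℝ} (hU : ∑ k : Fin K,
        ucbToGo v (D.take k k.isLt.le) (exploreBonus S A d H L δ) 0 H x₁ ≤
      ∑ k : Fin K, ∑ i : Fin H,
        drift v P d L δ (D.take k k.isLt.le) i (D k i).1 (D k i).2.1 + η)
    {r : Reward S A} (hr : r.IsUnit) :
    K * (optValue H P r x₁ - uniformValue H P r (fun k : Fin K => greedy g v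
        (D.take k k.isLt.le) (planBonus S A d H L δ) r) x₁) ≤
      Fintype.card Cell * (2 * H ^ 2) +
      3 * (3 * √(Fintype.card S * (H : ℝ) ^ 2 * logFactor S A H L δ / 2)) *
        √(Fintype.card Cell * (K * H : ℕ)) +
      2 * (3 * (H : ℝ) ^ 2 * Fintype.card S * logFactor S A H L δ) *
        (Fintype.card Cell * Real.log (K * H : ℕ)) + 6 / L * (K * H : ℕ) + η := by
  have hKpos : (0 : ℝ) < K := by exact_mod_cast hK
  have h1 : ∀ k : Fin K, optValue H P r x₁ -
      value H P r (greedy g v (D.take k k.isLt.le) (planBonus S A d H L δ) r) x₁ ≤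
      ucbToGo v (D.take k k.isLt.le) (exploreBonus S A d H L δ) 0 H x₁ := by
    intro k
    have hopt : optValue H P r x₁ ≤
        ucbToGo v (D.take k k.isLt.le) (planBonus S A d H L δ) r H x₁ := by
      have : Nonempty (Policy S A) := ⟨fun _ _ => PMF.pure (Classical.arbitrary A)⟩
      exact ciSup_le fun π => valueFrom_le_ucbToGo (hc k k.isLt) hd hr π H 0 (zero_add H) x₁
    have := ucbToGo_sub_valueFrom_le (hc k k.isLt) hd hι hr g H 0 (zero_add H) x₁
    rw [value_eq_valueFrom]
    linarith
  have h2 : K * (optValue H P r x₁ - uniformValue H P r (fun k : Fin K => greedy g v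
        (D.take k k.isLt.le) (planBonus S A d H L δ) r) x₁) =
      ∑ k : Fin K, (optValue H P r x₁ -
        value H P r (greedy g v (D.take k k.isLt.le) (planBonus S A d H L δ) r) x₁) := by
    rw [Finset.sum_sub_distrib, Finset.sum_const, Finset.card_univ, Fintype.card_fin,
      nsmul_eq_mul, uniformValue, mul_sub, mul_div_cancel₀ _ hKpos.ne']
  rw [h2]
  refine (Finset.sum_le_sum fun k _ => h1 k).trans (hU.trans ?_)
  refine add_le_add_left ?_ _
  have h3 : ∀ (k : Fin K) (i : Fin H), drift v P d L δ (D.take k k.isLt.le) i (D k i).1 (D k i).2.1 ≤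
      driftBound S A d H L δ (∑ j : Fin k, ∑ i' : Fin H,
        if cell i' (D (Fin.castLE k.isLt.le j) i').1 (D (Fin.castLE k.isLt.le j) i').2.1 =
          cell i (D k i).1 (D k i).2.1 then 1 else 0) := by
    intro k i
    refine (drift_le (hc k k.isLt) hd hι i.isLt _ _).trans_eq ?_
    rw [count_eq_sum]
    simp only [hcell]
    rfl
  refine (Finset.sum_le_sum fun k _ => Finset.sum_le_sum fun i _ => h3 k i).trans ?_
  refine (sum_visits_le (fun (j : Fin K) (i : Fin H) => cell i (D j i).1 (D j i).2.1)
    (Φ := potential H (3 * √(Fintype.card S * (H : ℝ) ^ 2 * logFactor S A H L δ / 2))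
      (3 * (H : ℝ) ^ 2 * Fintype.card S * logFactor S A H L δ) (6 / L)) (by simp [potential])
    (mul_le_potential_sub (by positivity) (by positivity) (by positivity)
      (driftBound_le d H L δ) fun n hn => driftBound_le_of_pos hd H L δ hn)).trans ?_
  refine sum_potential_le (by positivity) (by positivity) _ ?_
  rw [Finset.sum_comm]
  simp_rw [Finset.sum_comm (s := (Finset.univ : Finset Cell))]
  simp

/-- The sample complexity of the algorithm, in terms of the number of cells of pooled data. -/
theorem isPAC_of_cells {v : Version} {P : Transition S A} (hP : v.Admits P) (g : ArgmaxRule A)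
    (x₁ : S) {H K : ℕ} {δ ε : ℝ} (hH : 1 ≤ H) (hA : 2 ≤ Fintype.card A) (hδ : 0 < δ) (hδ1 : δ < 1)
    (hε : 0 < ε) (hε1 : ε < 1)
    (hει : ε * Real.log (H * Fintype.card S * Fintype.card A / (δ * ε)) ≤ H)
    {Cell : Type*} [Fintype Cell] [DecidableEq Cell] {cell : Fin H → S → A → Cell}
    (hcell : ∀ i x a i' x' a', cell i' x' a' = cell i x a ↔
      v.pools i i' = true ∧ x' = x ∧ a' = a)
    (hcard : 0 < Fintype.card Cell)
    (hW : (H : ℝ) ^ 3 * Fintype.card S * Fintype.card Cell ≤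
      ((H : ℝ) * Fintype.card S * Fintype.card A) ^ 4)
    (hK : 10 ^ 8 * ((H : ℝ) ^ 3 * Fintype.card S * Fintype.card Cell *
      Real.log (H * Fintype.card S * Fintype.card A / (δ * ε)) / ε ^ 2) ≤ K) :
    IsPAC H P x₁ ε δ (exploreLaw g v (Fintype.card S * Fintype.card A) H K δ P x₁ K)
      (planPolicies g v (Fintype.card S * Fintype.card A) H K δ) := by
  have hSn : 0 < Fintype.card S := Fintype.card_pos_iff.2 ⟨x₁⟩
  have hS1 : (1 : ℝ) ≤ Fintype.card S := by exact_mod_cast hSn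
  have hA2 : (2 : ℝ) ≤ Fintype.card A := by exact_mod_cast hA
  have hH1 : (1 : ℝ) ≤ H := by exact_mod_cast hH
  have hM1 : (1 : ℝ) ≤ Fintype.card Cell := by exact_mod_cast hcard
  have hd : Fintype.card S ≤ Fintype.card S * Fintype.card A := Nat.le_mul_of_pos_right _ (by omega)
  generalize hdd : Fintype.card S * Fintype.card A = d at hd ⊢
  have hIeq := logFactor_eq (S := S) (A := A) (H := H) (L := K) δ
  set I := logFactor S A H K δ with hI
  set s : ℝ := ((Fintype.card S : ℕ) : ℝ) with hs
  set m : ℝ := ((Fintype.card Cell : ℕ) : ℝ) with hm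
  set a : ℝ := ((Fintype.card A : ℕ) : ℝ) with ha
  set X : ℝ := H * s * a with hX
  set ι := Real.log (X / (δ * ε)) with hι
  set W := (H : ℝ) ^ 3 * s * m with hWdef
  have hHs : 1 ≤ (H : ℝ) * s := one_le_mul_of_one_le_of_one_le hH1 hS1
  have hX2 : 2 ≤ X := by nlinarith
  have hδε : δ * ε < 1 := by nlinarith
  have hιpos : 0 < ι := Real.log_pos (by rw [lt_div_iff₀ (by positivity)]; nlinarith)
  have hWpos : 0 < W := by positivity
  have hKpos : (0 : ℝ) < K := lt_of_lt_of_le (by positivity) hK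
  have hK0 : 0 < K := by exact_mod_cast hKpos
  have hK1 : (1 : ℝ) ≤ K := by exact_mod_cast hK0
  -- the multiple of the sample complexity that `K` is
  obtain ⟨t, ht, hKt⟩ : ∃ t : ℝ, 100 ≤ t ∧ K * ε ^ 2 = t ^ 4 * (W * ι) := by
    have hu : 10 ^ 8 ≤ K * ε ^ 2 / (W * ι) := by
      rw [le_div_iff₀ (by positivity)]
      rw [← mul_div_assoc, div_le_iff₀ (by positivity)] at hK
      linarith
    -- Since `K` may be arbitrarily large, the bonuses' logarithm cannot be bounded by a multiple of
    -- `ι` alone; it is bounded by `16 * t * ι`, with `t` a fourth root, so that even its square is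
    -- beaten by `t ^ 4`. The threshold 100 is the fourth root of `10 ^ 8`.
    refine ⟨√√(K * ε ^ 2 / (W * ι)), ?_, ?_⟩
    · refine Real.le_sqrt_of_sq_le (Real.le_sqrt_of_sq_le ?_)
      norm_num at hu ⊢
      exact hu
    · rw [show (4 : ℕ) = 2 * 2 from rfl, pow_mul, Real.sq_sqrt (Real.sqrt_nonneg _),
        Real.sq_sqrt (by positivity), div_mul_cancel₀ _ (by positivity)]
  set y := 6 * (H : ℝ) ^ 2 * s * a * (K : ℝ) ^ 2 / δ with hy
  have hHK1 : 1 ≤ (H : ℝ) * K := one_le_mul_of_one_le_of_one_le hH1 hK1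
  have hsa1 : 1 ≤ s * a := one_le_mul_of_one_le_of_one_le hS1 (by linarith)
  have hy_eq : y = 6 * (s * a) * (H * K) ^ 2 / δ := by rw [hy]; ring
  have hbig : 1 ≤ (s * a) * ((H : ℝ) * K) ^ 2 :=
    one_le_mul_of_one_le_of_one_le hsa1 (one_le_pow₀ hHK1)
  have hyδ : 3 / δ ≤ y := by
    rw [hy_eq]
    exact div_le_div_of_nonneg_right (by linarith) hδ.le
  have hy3 : 3 ≤ y := le_trans (by rw [le_div_iff₀ hδ]; linarith) hyδ
  have hy0 : 0 < y := by linarith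
  have hI1 : 1 ≤ I := by
    rw [hIeq, Real.le_log_iff_exp_le hy0]
    exact (Real.exp_one_lt_d9.trans (by norm_num)).le.trans hy3
  have hI0 : 0 ≤ I := by linarith
  have hIt : I ≤ 16 * t * ι := by
    refine le_trans ?_ (log_factor_le hX2 hWpos hW hδ hδ1 hε hε1 (by linarith) hKt)
    rw [hIeq]
    refine Real.log_le_log hy0 (div_le_div_of_nonneg_right ?_ hδ.le)
    have h1 : 6 * X ^ 2 * (K : ℝ) ^ 2 = 6 * (H : ℝ) ^ 2 * s * a * (K : ℝ) ^ 2 * (s * a) := by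
      rw [hX]; ring
    rw [h1]
    exact le_mul_of_one_le_right (by positivity) hsa1
  have hIδ : Real.log (1 / (δ / 3)) ≤ I := by
    rw [hIeq, one_div_div]
    exact Real.log_le_log (by positivity) hyδ
  have hIHK : Real.log (K * H : ℕ) ≤ I := by
    rw [hIeq]
    refine Real.log_le_log (by positivity) ?_
    rw [hy_eq, le_div_iff₀ hδ]
    push_cast
    calc (K : ℝ) * H * δ ≤ K * H := mul_le_of_le_one_right (by positivity) hδ1.le
      _ = H * K := mul_comm _ _
      _ ≤ (H * K) ^ 2 := le_self_pow₀ hHK1 two_ne_zero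
      _ ≤ 6 * (s * a) * (H * K) ^ 2 := le_mul_of_one_le_left (sq_nonneg _) (by linarith)
  obtain ⟨f₁, hf₁, hf₁E, hf₁D⟩ := exists_concentrated g d H K δ x₁ hP K
    (mul_nonneg (by linarith : 0 ≤ s) hI0)
  obtain ⟨f₂, hf₂, hf₂E, hf₂D⟩ := exists_sum_ucbToGo_le g v P x₁ d H K hI0
    (η := δ / 3) (by positivity) (by linarith) (K := K)
  refine le_prob_of_expect (f := fun D => f₁ D + f₂ D) (fun D => add_nonneg (hf₁ D) (hf₂ D)) ?_ ?_
  · intro D hD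
    by_contra! hlt
    refine hD fun r hr => ?_
    have h1 := optValue_sub_uniformValue_le g x₁ hd hK0 hI0 hcell
      (hf₁D D (by linarith [hf₂ D])) (hf₂D D (by linarith [hf₁ D])) hr
    refine le_of_mul_le_mul_left (h1.trans ?_) hKpos
    rw [mul_comm (K : ℝ) ε]
    refine le_trans ?_ (regret_bound_le (G := (H : ℝ) ^ 2 * s * m) (by positivity)
      (by linarith : (0 : ℝ) < H) (by rw [hWdef]; ring) hε ht hιpos.le hI0 hIt hει hKpos.le hKt)
    rw [← hI, ← hs, ← hm]
    push_cast at hIHK ⊢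
    exact regret_terms_le hH1 hS1 hM1 hI1 hK1 hWdef hIδ hIHK
  · rw [expect_add]
    have h1 : H * K * s * a * 2 ^ Fintype.card S * (H * K) * Real.exp (-(s * I)) ≤ δ / 3 := by
      have h2 : Real.exp (-(s * I)) = (1 / y) ^ Fintype.card S := by
        rw [one_div, ← Real.exp_log (inv_pos.2 hy0), ← Real.exp_nat_mul, Real.log_inv, ← hIeq, ← hs,
          mul_neg]
      rw [h2]
      -- The 6 in the logarithm makes this exactly `δ / 3`. The martingale event costs another `δ /
      -- 3`.
      refine (union_bound_le hSn.ne' (by linarith : 2 ≤ y) (by positivity)).trans (le_of_eq ?_)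
      rw [hy_eq]
      field_simp
      norm_num
    linarith

/-- With a single action there is a single policy. -/
theorem isPAC_of_card_le_one {S A : Type*} [Fintype S] [Fintype A] (hA : Fintype.card A ≤ 1) (H : ℕ) (P : Transition S A) (x₁ : S)
    {ε δ : ℝ} (hε : 0 ≤ ε) (hδ : 0 ≤ δ) {Ω : Type*} [Fintype Ω] {K : ℕ} (hK : 0 < K) (law : PMF Ω)
    (plan : Ω → Reward S A → Fin K → Policy S A) : IsPAC H P x₁ ε δ law plan := by
  have hsub := Fintype.card_le_one_iff_subsingleton.1 hA
  have hPMF : Subsingleton (PMF A) := ⟨fun p q => by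
    have h : ∀ p : PMF A, ∀ a, (p a).toReal = 1 := fun p a => by
      rw [← sum_toReal p]
      exact (Fintype.sum_subsingleton (fun a => (p a).toReal) a).symm
    ext a
    rw [← ENNReal.toReal_eq_toReal_iff' (p.apply_ne_top a) (q.apply_ne_top a), h, h]⟩
  refine le_prob_of_expect (f := fun _ => 0) (fun _ => le_rfl) (fun D hD => (hD fun r _ => ?_).elim)
    (by rwa [expect_const])
  have hKpos : (0 : ℝ) < K := by exact_mod_cast hK
  have h1 : ∀ π : Policy S A, value H P r π x₁ = value H P r (plan D r ⟨0, hK⟩) x₁ := fun π => by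
    rw [Subsingleton.elim π (plan D r ⟨0, hK⟩)]
  have : Nonempty (Policy S A) := ⟨plan D r ⟨0, hK⟩⟩
  simp only [optValue, uniformValue, h1, ciSup_const, Finset.sum_const, Finset.card_univ,
    Fintype.card_fin, nsmul_eq_mul]
  rw [mul_div_cancel_left₀ _ hKpos.ne', sub_self]
  exact hε

end Regret

end PFUCB

/-! ### The two versions as choices of the cells of pooled data. -/

theorem corollary5 :
    ∃ C : ℝ, 0 < C ∧
      ∀ (S A : Type*) [Fintype S] [Fintype A] [DecidableEq S] [DecidableEq A] [Nonempty A]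
        (x₁ : S) (g : PFUCB.ArgmaxRule A) (H : ℕ) (δ ε : ℝ),
        1 ≤ H → 0 < δ → δ < 1 → 0 < ε → ε < 1 →
        ε * Real.log (H * Fintype.card S * Fintype.card A / (δ * ε)) ≤ H →
        -- stationary transition probabilities
        (∀ (P : S → A → PMF S) (K : ℕ),
          C * ((H : ℝ) ^ 3 * (Fintype.card S : ℝ) ^ 2 * Fintype.card A *
              Real.log (H * Fintype.card S * Fintype.card A / (δ * ε)) / ε ^ 2) ≤ K →
          PFUCB.IsPAC H (fun _ => P) x₁ ε δ
            (PFUCB.exploreLaw g .stationary (Fintype.card S * Fintype.card A) H K δ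
              (fun _ => P) x₁ K)
            (PFUCB.planPolicies g .stationary (Fintype.card S * Fintype.card A) H K δ)) ∧
        -- non-stationary transition probabilities
        (∀ (P : ℕ → S → A → PMF S) (K : ℕ),
          C * ((H : ℝ) ^ 4 * (Fintype.card S : ℝ) ^ 2 * Fintype.card A *
              Real.log (H * Fintype.card S * Fintype.card A / (δ * ε)) / ε ^ 2) ≤ K →
          PFUCB.IsPAC H P x₁ ε δ
            (PFUCB.exploreLaw g .nonstationary (Fintype.card S * Fintype.card A) H K δ P x₁ K)
            (PFUCB.planPolicies g .nonstationary (Fintype.card S * Fintype.card A) H K δ)) := by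
  refine ⟨10 ^ 8, by norm_num, ?_⟩
  intro S A _ _ _ _ _ x₁ g H δ ε hH hδ hδ1 hε hε1 hει
  have hS1 : (1 : ℝ) ≤ Fintype.card S := by exact_mod_cast Fintype.card_pos_iff.2 ⟨x₁⟩
  have hA1 : (1 : ℝ) ≤ Fintype.card A := by exact_mod_cast Fintype.card_pos
  have hH1 : (1 : ℝ) ≤ H := by exact_mod_cast hH
  have hι : 0 < Real.log (H * Fintype.card S * Fintype.card A / (δ * ε)) := by
    refine Real.log_pos ?_
    rw [lt_div_iff₀ (by positivity)]
    have h1 : 1 ≤ (H : ℝ) * Fintype.card S * Fintype.card A :=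
      one_le_mul_of_one_le_of_one_le (one_le_mul_of_one_le_of_one_le hH1 hS1) hA1
    nlinarith
  have hK0 : ∀ {K : ℕ} {c : ℝ}, 0 < c → c ≤ K → 0 < K := fun hc h => by
    exact_mod_cast hc.trans_le h
  -- With one action `ι` can be arbitrarily close to 0, where the logarithmic comparison fails. Two
  -- actions force `H|S||A| ≥ 2`, hence `ι ≥ log 2`.
  by_cases hA : Fintype.card A ≤ 1
  · exact ⟨fun P K hK => PFUCB.isPAC_of_card_le_one hA H _ x₁ hε.le hδ.le
        (hK0 (by positivity) hK) _ _,
      fun P K hK => PFUCB.isPAC_of_card_le_one hA H _ x₁ hε.le hδ.le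
        (hK0 (by positivity) hK) _ _⟩
  push Not at hA
  constructor
  · intro P K hK
    refine PFUCB.isPAC_of_cells (Cell := S × A) (cell := fun _ x a => (x, a))
      (fun _ _ _ => rfl) g x₁ hH hA hδ hδ1 hε hε1 hει ?_ ?_ ?_ ?_
    · intro i x a i' x' a'
      simp [PFUCB.Version.pools]
    · exact Fintype.card_pos_iff.2 ⟨(x₁, Classical.arbitrary A)⟩
    · rw [Fintype.card_prod]
      push_cast
      calc _ = (H : ℝ) ^ 3 * (Fintype.card S : ℝ) ^ 2 * (Fintype.card A : ℝ) ^ 1 := by ring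
        _ ≤ (H : ℝ) ^ 4 * (Fintype.card S : ℝ) ^ 4 * (Fintype.card A : ℝ) ^ 4 := by
          gcongr <;> first | assumption | norm_num
        _ = _ := by ring
    · rw [Fintype.card_prod]
      push_cast
      refine le_trans (le_of_eq ?_) hK
      ring
  · intro P K hK
    refine PFUCB.isPAC_of_cells (Cell := Fin H × S × A) (cell := fun i x a => (i, x, a))
      ?_ g x₁ hH hA hδ hδ1 hε hε1 hει ?_ ?_ ?_ ?_
    · intro h i hi
      simp only [PFUCB.Version.pools, decide_eq_true_eq] at hi
      rw [hi]
    · intro i x a i' x' a'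
      simp [PFUCB.Version.pools, Fin.ext_iff]
    · exact Fintype.card_pos_iff.2 ⟨(⟨0, hH⟩, x₁, Classical.arbitrary A)⟩
    · rw [Fintype.card_prod, Fintype.card_prod, Fintype.card_fin]
      push_cast
      calc _ = (H : ℝ) ^ 4 * (Fintype.card S : ℝ) ^ 2 * (Fintype.card A : ℝ) ^ 1 := by ring
        _ ≤ (H : ℝ) ^ 4 * (Fintype.card S : ℝ) ^ 4 * (Fintype.card A : ℝ) ^ 4 := by
          gcongr <;> first | assumption | norm_num
        _ = _ := by ring
    · rw [Fintype.card_prod, Fintype.card_prod, Fintype.card_fin]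
      push_cast
      refine le_trans (le_of_eq ?_) hK
      ring
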